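/- For a real number $x \ge 1$, an integer $q \ge 1$ and $a \in (\mathbb{Z}/q\mathbb{Z})^{\times}$, put \[ S(x;q,a) = \sum_{\substack{1 \le n \le x \\ n \equiv a \,(\mathrm{mod}\, q)}} |\mu(n)|, \qquad c_q = \prod_{p \nmid q}\Bigl(1 - \frac{1}{p^2}\Bigr), \qquad E(x;q,a) = S(x;q,a) - c_q \frac{x}{q}, \] where $\mu$ is the Möbius function and the product runs over the primes $p$ not dividing $q$. Let $\varepsilon > 0$ be fixed. Then there is a constant $C > 0$ depending only on $\varepsilon$ such that for all real $x \ge 1$ and all integers $q \ge 1$ with $x^{1/2} \le q \le x$, \[ \frac{1}{\varphi(q)} \, \#\left\{ a \in (\mathbb{Z}/q\mathbb{Z})^{\times} : |E(x;q,a)| > \left(\frac{x}{q}\right)^{1/4} x^{\varepsilon} \right\} \le C\, x^{-\varepsilon}, \] where $\varphi$ is Euler's totient function. -/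

import Mathlib

namespace SquarefreeAP

/-- `S(x; q, a)`: the sum of `|μ(n)|` over the integers `1 ≤ n ≤ x` with `n ≡ a (mod q)`,
i.e. the number of squarefree positive integers up to `x` in the class `a`. -/
noncomputable def S (x : ℝ) (q : ℕ) (a : (ZMod q)ˣ) : ℝ :=
  ∑ n ∈ (Finset.Icc 1 ⌊x⌋₊).filter (fun n : ℕ => (n : ZMod q) = (a : ZMod q)),
    |(ArithmeticFunction.moebius n : ℝ)|

/-- `c_q`: the product of `1 - 1 / p ^ 2` over all primes `p` not dividing `q`. -/
noncomputable def c (q : ℕ) : ℝ :=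
  ∏' p : {p : ℕ // p.Prime ∧ ¬ p ∣ q}, (1 - 1 / ((p : ℕ) : ℝ) ^ 2)

/-- The product defining `c_q` converges (unconditionally), so `c q` is its value. -/
theorem hasProd_c (q : ℕ) :
    HasProd (fun p : {p : ℕ // p.Prime ∧ ¬ p ∣ q} => 1 - 1 / ((p : ℕ) : ℝ) ^ 2) (c q) := by
  have hs : Summable (fun p : {p : ℕ // p.Prime ∧ ¬ p ∣ q} => -(1 / ((p : ℕ) : ℝ) ^ 2)) :=
    ((Real.summable_one_div_nat_pow.2 one_lt_two).subtype
      {p : ℕ | p.Prime ∧ ¬ p ∣ q}).neg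
  have hm := Real.multipliable_one_add_of_summable hs
  simp only [← sub_eq_add_neg] at hm
  exact hm.hasProd

/-- The error term `E(x; q, a) = S(x; q, a) - c_q x / q`. -/
noncomputable def E (x : ℝ) (q : ℕ) (a : (ZMod q)ˣ) : ℝ :=
  S x q a - c q * (x / q)

end SquarefreeAP

namespace SquarefreeAP

/-! The result is Chebyshev's inequality applied to the variance bound `sum_sq_E_le`: up to
divisor-function factors, the sum of E(x;q,a)² over reduced a is at most √(xq), so few classes can
exceed (x/q)^(1/4) x^ε.

For the variance, write |μ(n)| as the sum of μ(d) over d² ∣ n and cut at d ≈ (xq)^(1/4). For small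
d, Parseval on ℤ/q removes the expected value together with the zero frequency; the other
frequencies give exponential sums bounded by min(x/d², 1/‖d²b/q‖), with ‖·‖ the distance to the
nearest integer. For large d, the solutions of d²m ≡ a are counted without using cancellation. After
a dyadic decomposition both ranges need the second moment over b of the number of d ≤ D for which
d²b, or its inverse, has a representative of size at most H.

That moment is controlled by multiplicative energy (`sq_sum_sq_twisted_le`). Opening the square
decouples it into correlations of the two intervals at w and at w². Cauchy–Schwarz separates them,
at the cost of the number of square roots of 1 modulo q. The energy of an interval is small by the
divisor bound (`energy_residueCount_le`). The hypothesis √x ≤ q enters when the dyadic contributions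
are summed up in `small_range_bound` and `large_range_bound`. -/

/-! ### Divisor function and totient. -/

theorem exists_card_divisors_le_rpow {δ : ℝ} (hδ : 0 < δ) :
    ∃ C : ℝ, 1 ≤ C ∧ ∀ n : ℕ, n ≠ 0 → (n.divisors.card : ℝ) ≤ C * (n : ℝ) ^ δ := by
  have hlog : 0 < Real.log 2 := Real.log_pos one_lt_two
  -- Chosen so that K·δe·log 2 already contains the summand e, making e + 1 ≤ K·(1 + δe·log 2).
  set K : ℝ := 1 + 1 / (δ * Real.log 2) with hK
  have hK1 : 1 ≤ K := by rw [hK]; linarith [show 0 < 1 / (δ * Real.log 2) by positivity]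
  set P : ℕ := ⌈(2 : ℝ) ^ (1 / δ)⌉₊ with hP
  have small : ∀ p : ℕ, 2 ≤ p → ∀ e : ℕ, (e : ℝ) + 1 ≤ K * ((p : ℝ) ^ δ) ^ e := by
    intro p hp e
    have hp' : (2 : ℝ) ≤ p := by exact_mod_cast hp
    have h1 : ((2 : ℝ) ^ δ) ^ e ≤ ((p : ℝ) ^ δ) ^ e := by gcongr
    have h2 : 1 + δ * e * Real.log 2 ≤ ((2 : ℝ) ^ δ) ^ e := by
      rw [← Real.rpow_natCast, ← Real.rpow_mul (by norm_num), Real.rpow_def_of_pos two_pos]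
      have := Real.add_one_le_exp (Real.log 2 * (δ * e))
      linarith
    have h3 : (e : ℝ) + 1 ≤ K * (1 + δ * e * Real.log 2) := by
      have : K * (1 + δ * e * Real.log 2)
          = 1 + 1 / (δ * Real.log 2) + δ * e * Real.log 2 + e := by
        rw [hK]; field_simp; ring
      rw [this]
      have : 0 ≤ 1 / (δ * Real.log 2) + δ * e * Real.log 2 := by positivity
      linarith
    exact h3.trans (mul_le_mul_of_nonneg_left (h2.trans h1) (by linarith))
  -- Once p ≥ 2^(1/δ), p^δ ≥ 2 and e + 1 ≤ 2^e suffices; hence only primes below P cost a factor K.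
  have large : ∀ p : ℕ, P ≤ p → ∀ e : ℕ, (e : ℝ) + 1 ≤ ((p : ℝ) ^ δ) ^ e := by
    intro p hp e
    have h1 : (2 : ℝ) ≤ (p : ℝ) ^ δ := by
      have : (2 : ℝ) ^ (1 / δ) ≤ p := (Nat.le_ceil _).trans (by exact_mod_cast hp)
      calc (2 : ℝ) = ((2 : ℝ) ^ (1 / δ)) ^ δ := by
            rw [← Real.rpow_mul (by norm_num), one_div_mul_cancel hδ.ne', Real.rpow_one]
        _ ≤ _ := by gcongr
    have h2 : ((e + 1 : ℕ) : ℝ) ≤ (2 : ℝ) ^ e := by exact_mod_cast Nat.lt_two_pow_self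
    push_cast at h2
    exact h2.trans (by gcongr)
  refine ⟨K ^ P, one_le_pow₀ hK1, fun n hn => ?_⟩
  rw [Nat.card_divisors hn]
  push_cast
  have hn' : (n : ℝ) ^ δ = ∏ p ∈ n.primeFactors, ((p : ℝ) ^ δ) ^ (n.factorization p) := by
    conv_lhs => rw [← Nat.prod_factorization_pow_eq_self hn]
    rw [Finsupp.prod, Nat.cast_prod, ← Real.finsetProd_rpow _ _ (fun _ _ => by positivity)]
    refine Finset.prod_congr rfl fun p _ => ?_
    push_cast
    rw [← Real.rpow_natCast, ← Real.rpow_natCast, ← Real.rpow_mul (by positivity),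
      ← Real.rpow_mul (by positivity), mul_comm]
  have hprod : ∏ p ∈ n.primeFactors, (if p < P then K else 1) ≤ K ^ P := by
    rw [Finset.prod_ite, Finset.prod_const, Finset.prod_const_one, mul_one]
    refine pow_le_pow_right₀ hK1 ?_
    calc _ ≤ (Finset.range P).card := Finset.card_le_card fun p hp => by
            simp only [Finset.mem_filter] at hp; simpa using hp.2
      _ = P := Finset.card_range P
  rw [hn']
  calc ∏ p ∈ n.primeFactors, ((n.factorization p : ℝ) + 1)
      ≤ ∏ p ∈ n.primeFactors, ((if p < P then K else 1) * ((p : ℝ) ^ δ) ^ n.factorization p) := by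
        refine Finset.prod_le_prod (fun _ _ => by positivity) fun p hp => ?_
        split_ifs with h
        · exact small p (Nat.prime_of_mem_primeFactors hp).two_le _
        · rw [one_mul]; exact large p (not_lt.1 h) _
    _ = (∏ p ∈ n.primeFactors, (if p < P then K else 1)) * _ := Finset.prod_mul_distrib
    _ ≤ _ := by gcongr

/-- Prime by prime, p ≤ (p - 1)(e + 1) for every exponent e ≥ 1. -/
theorem le_totient_mul_card_divisors {n : ℕ} (hn : n ≠ 0) :
    n ≤ n.totient * n.divisors.card := by
  rw [Nat.card_divisors hn, Nat.totient_eq_prod_factorization hn]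
  conv_lhs => rw [← Nat.prod_factorization_pow_eq_self hn]
  rw [Finsupp.prod, Finsupp.prod, Nat.support_factorization, ← Finset.prod_mul_distrib]
  refine Finset.prod_le_prod' fun p hp => ?_
  have hp2 := (Nat.prime_of_mem_primeFactors hp).two_le
  have he : n.factorization p ≠ 0 := by
    rw [← Finsupp.mem_support_iff, Nat.support_factorization]; exact hp
  obtain ⟨e, he⟩ := Nat.exists_eq_succ_of_ne_zero he
  obtain ⟨r, rfl⟩ := Nat.exists_eq_add_of_le hp2
  rw [he]
  simp only [Nat.succ_eq_add_one, Nat.add_sub_cancel, pow_succ]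
  rw [show 2 + r - 1 = r + 1 by omega, mul_assoc]
  refine Nat.mul_le_mul_left _ ?_
  nlinarith

/-! ### Square roots of one modulo q. -/

/-- Two square roots of `1` modulo `q` in the same "gcd class" differ by `2`-torsion. -/
theorem dvd_two_mul_sub_of_gcd_eq {q v w : ℤ} (hq : q ≠ 0) (hv : q ∣ (v - 1) * (v + 1))
    (hw : q ∣ (w - 1) * (w + 1)) (h : Int.gcd (v - 1) q = Int.gcd (w - 1) q) :
    q ∣ 2 * (v - w) := by
  -- Dividing out g = gcd(u - 1, q) leaves f = q/g coprime to (u - 1)/g, so f must divide u + 1.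
  -- With a common g, the factors of q can be taken one from v and one from w.
  have key : ∀ u : ℤ, q ∣ (u - 1) * (u + 1) →
      ∃ f, q = f * (Int.gcd (u - 1) q : ℤ) ∧ f ∣ u + 1 := by
    intro u hu
    have hpos : 0 < Int.gcd (u - 1) q := Int.gcd_pos_of_ne_zero_right _ hq
    obtain ⟨k, f, hco, hk, hf⟩ := Int.exists_gcd_one hpos
    refine ⟨f, hf, ?_⟩
    have hg : (Int.gcd (u - 1) q : ℤ) ≠ 0 := by exact_mod_cast hpos.ne'
    obtain ⟨m, hm⟩ := hu
    refine (Int.isCoprime_iff_gcd_eq_one.2 hco).symm.dvd_of_dvd_mul_left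
      (show f ∣ k * (u + 1) from ⟨m, mul_left_cancel₀ hg ?_⟩)
    linear_combination hm - (u + 1) * hk + m * hf
  obtain ⟨f, hf, hfv⟩ := key v hv
  obtain ⟨f', hf', hfw⟩ := key w hw
  have hgw : (Int.gcd (w - 1) q : ℤ) ≠ 0 := by
    exact_mod_cast (Int.gcd_pos_of_ne_zero_right _ hq).ne'
  rw [h] at hf
  obtain rfl : f = f' := mul_right_cancel₀ hgw (hf.symm.trans hf')
  have h1 : q ∣ (v - 1) * (w + 1) := by
    rw [mul_comm, hf]; exact mul_dvd_mul hfw (h ▸ Int.gcd_dvd_left ..)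
  have h2 : q ∣ (w - 1) * (v + 1) := by
    rw [mul_comm, hf]; exact mul_dvd_mul hfv (Int.gcd_dvd_left ..)
  have h3 := dvd_sub h1 h2
  rwa [show (v - 1) * (w + 1) - (w - 1) * (v + 1) = 2 * (v - w) by ring] at h3

/-- Group the roots w by gcd(w - 1, q), a divisor of q. Inside a group all differences are killed by
2, and a cyclic group has at most two such elements. -/
theorem card_sq_eq_one_le (q : ℕ) [NeZero q] :
    (Finset.univ.filter fun w : (ZMod q)ˣ => w ^ 2 = 1).card ≤ 2 * q.divisors.card := by
  classical
  have hq : q ≠ 0 := NeZero.ne q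
  have hdvd : ∀ w : (ZMod q)ˣ, w ^ 2 = 1 →
      (q : ℤ) ∣ (((w : ZMod q).val : ℤ) - 1) * (((w : ZMod q).val : ℤ) + 1) := by
    intro w hw
    rw [← ZMod.intCast_zmod_eq_zero_iff_dvd _ q]
    have : (w : ZMod q) ^ 2 = 1 := by rw [← Units.val_pow_eq_pow_val, hw]; rfl
    push_cast
    rw [ZMod.natCast_zmod_val]
    linear_combination this
  refine Finset.card_le_mul_card_image_of_maps_to
    (f := fun w : (ZMod q)ˣ => Int.gcd (((w : ZMod q).val : ℤ) - 1) q) ?_ 2 ?_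
  · intro w _
    rw [Nat.mem_divisors]
    exact ⟨by exact_mod_cast Int.gcd_dvd_right (((w : ZMod q).val : ℤ) - 1) (q : ℤ), hq⟩
  · intro g _
    rcases Finset.eq_empty_or_nonempty (Finset.filter (fun w : (ZMod q)ˣ => Int.gcd (((w : ZMod q).val : ℤ) - 1) q = g)
      (Finset.univ.filter fun w : (ZMod q)ˣ => w ^ 2 = 1)) with h0 | ⟨(w₀ : (ZMod q)ˣ), hw₀⟩
    · rw [h0]; simp
    · refine le_trans ?_ (IsAddCyclic.card_nsmul_eq_zero_le (α := ZMod q) (n := 2) two_pos)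
      refine Finset.card_le_card_of_injOn (fun w => (w : ZMod q) - w₀) ?_ ?_
      · intro w hw
        simp only [Finset.coe_filter, Finset.mem_filter, Finset.mem_univ, true_and,
          Set.mem_ofPred_eq] at hw hw₀ ⊢
        have := dvd_two_mul_sub_of_gcd_eq (by exact_mod_cast hq) (hdvd w hw.1) (hdvd w₀ hw₀.1)
          (hw.2.trans hw₀.2.symm)
        rw [← ZMod.intCast_zmod_eq_zero_iff_dvd _ q] at this
        push_cast at this
        rw [ZMod.natCast_zmod_val, ZMod.natCast_zmod_val] at this
        rw [nsmul_eq_mul]; exact_mod_cast this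
      · intro w _ w' _ h
        exact Units.ext (sub_left_injective h)

/-! ### Multiplicative energy in a finite commutative group. -/

section Energy

variable {G : Type*} [CommGroup G] [Fintype G]

/-- The multiplicative energy of a weight on a finite commutative group. -/
def energy (f : G → ℝ) : ℝ := ∑ w, (∑ v, f (w * v) * f v) ^ 2

/-- Open the square over pairs (u, v) and substitute u = wv, t = v²b. Then u²b = w²t, so for fixed w
the sums over v and t are independent. -/
theorem sum_sq_twisted_eq (f g : G → ℝ) :
    ∑ b, (∑ u, f u * g (u ^ 2 * b)) ^ 2
      = ∑ w, (∑ v, f (w * v) * f v) * (∑ t, g (w ^ 2 * t) * g t) := by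
  have hl : ∀ b, (∑ u, f u * g (u ^ 2 * b)) ^ 2
      = ∑ v, ∑ u, f u * g (u ^ 2 * b) * (f v * g (v ^ 2 * b)) := by
    intro b; rw [sq, Finset.sum_mul_sum, Finset.sum_comm]
  have hr : ∀ w, (∑ v, f (w * v) * f v) * (∑ t, g (w ^ 2 * t) * g t)
      = ∑ v, ∑ t, f (w * v) * f v * (g (w ^ 2 * t) * g t) := by
    intro w; rw [Finset.sum_mul_sum]
  simp_rw [hl, hr]
  rw [Finset.sum_comm, Finset.sum_comm (s := Finset.univ (α := G))
    (f := fun w v => ∑ t, f (w * v) * f v * (g (w ^ 2 * t) * g t))]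
  refine Finset.sum_congr rfl fun v _ => ?_
  rw [Finset.sum_comm, ← Equiv.sum_comp (Equiv.mulRight v)]
  refine Finset.sum_congr rfl fun w _ => ?_
  rw [← Equiv.sum_comp (Equiv.mulLeft (v ^ 2))
    (fun t => f (w * v) * f v * (g (w ^ 2 * t) * g t))]
  refine Finset.sum_congr rfl fun b _ => ?_
  simp only [Equiv.coe_mulRight, Equiv.coe_mulLeft]
  rw [show (w * v) ^ 2 * b = w ^ 2 * (v ^ 2 * b) by rw [mul_pow, mul_assoc]]
  ring

/-- Energy can be counted through equal products instead of equal quotients: with n = wuv one has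
nu⁻¹ = wv and nv⁻¹ = wu. Products of integers are what the divisor bound can count. -/
theorem energy_eq_sum_convolution (f : G → ℝ) :
    energy f = ∑ n, (∑ v, f (n * v⁻¹) * f v) ^ 2 := by
  have hl : ∀ w, (∑ v, f (w * v) * f v) ^ 2
      = ∑ u, ∑ v, f (w * u) * f u * (f (w * v) * f v) := by
    intro b; rw [sq, Finset.sum_mul_sum]
  have hr : ∀ n, (∑ v, f (n * v⁻¹) * f v) ^ 2
      = ∑ u, ∑ v, f (n * u⁻¹) * f u * (f (n * v⁻¹) * f v) := by
    intro w; rw [sq, Finset.sum_mul_sum]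
  simp_rw [energy, hl, hr]
  rw [Finset.sum_comm, Finset.sum_comm (s := Finset.univ (α := G))
    (f := fun n u => ∑ v, f (n * u⁻¹) * f u * (f (n * v⁻¹) * f v))]
  refine Finset.sum_congr rfl fun u _ => ?_
  rw [Finset.sum_comm, Finset.sum_comm (s := Finset.univ (α := G))
    (f := fun n v => f (n * u⁻¹) * f u * (f (n * v⁻¹) * f v))]
  refine Finset.sum_congr rfl fun v _ => ?_
  rw [← Equiv.sum_comp (Equiv.mulRight (u * v))
    (fun n => f (n * u⁻¹) * f u * (f (n * v⁻¹) * f v))]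
  refine Finset.sum_congr rfl fun w _ => ?_
  simp only [Equiv.coe_mulRight]
  rw [show w * (u * v) * u⁻¹ = w * v by rw [mul_comm u v, ← mul_assoc, mul_inv_cancel_right],
    show w * (u * v) * v⁻¹ = w * u by rw [← mul_assoc, mul_inv_cancel_right]]
  ring

theorem energy_comp_inv (f : G → ℝ) : energy (fun u => f u⁻¹) = energy f := by
  unfold energy
  rw [← Equiv.sum_comp (Equiv.inv G)]
  refine Finset.sum_congr rfl fun w _ => ?_
  rw [← Equiv.sum_comp (Equiv.inv G)]
  simp [mul_comm]

theorem energy_nonneg (f : G → ℝ) : 0 ≤ energy f := Finset.sum_nonneg fun _ _ => sq_nonneg _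

/-- Every fibre of squaring is empty or a translate of the 2-torsion. -/
theorem sum_comp_sq_le [DecidableEq G] (F : G → ℝ) (hF : ∀ s, 0 ≤ F s) :
    ∑ w, F (w ^ 2) ≤ (Finset.univ.filter fun w : G => w ^ 2 = 1).card * ∑ s, F s := by
  rw [← Finset.sum_fiberwise Finset.univ (fun w : G => w ^ 2), Finset.mul_sum]
  refine Finset.sum_le_sum fun s _ => ?_
  rw [Finset.sum_congr rfl (g := fun _ => F s)
    fun w hw => by rw [(Finset.mem_filter.1 hw).2], Finset.sum_const, nsmul_eq_mul]
  refine mul_le_mul_of_nonneg_right ?_ (hF s)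
  norm_cast
  rcases Finset.eq_empty_or_nonempty (Finset.univ.filter fun w : G => w ^ 2 = s) with h | ⟨w₀, h₀⟩
  · rw [h]; simp
  · refine Finset.card_le_card_of_injOn (fun w => w * w₀⁻¹) ?_
      fun w _ w' _ h => mul_left_injective _ h
    intro w hw
    simp only [Finset.coe_filter, Finset.mem_filter, Finset.mem_univ, true_and,
      Set.mem_ofPred_eq] at hw h₀ ⊢
    rw [mul_pow, hw, inv_pow, h₀, mul_inv_cancel]

theorem sq_sum_sq_twisted_le [DecidableEq G] (f g : G → ℝ) :
    (∑ b, (∑ u, f u * g (u ^ 2 * b)) ^ 2) ^ 2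
      ≤ energy f * ((Finset.univ.filter fun w : G => w ^ 2 = 1).card * energy g) := by
  rw [sum_sq_twisted_eq]
  refine (Finset.sum_mul_sq_le_sq_mul_sq _ _ _).trans ?_
  exact mul_le_mul_of_nonneg_left
    (sum_comp_sq_le (fun s => (∑ t, g (s * t) * g t) ^ 2) fun _ => sq_nonneg _) (energy_nonneg f)

end Energy

/-! ### Energy of intervals and the resulting second moments. -/

/-- The number of `d ≤ D` in the reduced residue class `u`. -/
noncomputable def residueCount (q D : ℕ) (u : (ZMod q)ˣ) : ℝ :=
  ∑ d ∈ Finset.Icc 1 D, if (d : ZMod q) = u then 1 else 0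

theorem residueCount_nonneg (q D : ℕ) (u : (ZMod q)ˣ) : 0 ≤ residueCount q D u :=
  Finset.sum_nonneg fun _ _ => by split_ifs <;> norm_num

theorem card_filter_modEq_le {q : ℕ} (hq : q ≠ 0) (M : ℕ) (a : ZMod q) :
    (((Finset.Icc 1 M).filter fun k : ℕ => (k : ZMod q) = a).card : ℝ) ≤ M / q + 1 := by
  have : NeZero q := ⟨hq⟩
  have h : ((Finset.Icc 1 M).filter fun k : ℕ => (k : ZMod q) = a).card ≤ M / q + 1 := by
    calc _ ≤ (Finset.range (M / q + 1)).card := ?_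
      _ = _ := Finset.card_range _
    refine Finset.card_le_card_of_injOn (fun k => k / q) ?_ ?_
    · intro k hk
      simp only [Finset.coe_filter, Finset.mem_Icc, Set.mem_ofPred_eq] at hk
      simp only [Finset.coe_range, Set.mem_Iio]
      exact Nat.lt_succ_of_le (Nat.div_le_div_right hk.1.2)
    · intro k hk l hl hkl
      simp only [Finset.coe_filter, Finset.mem_Icc, Set.mem_ofPred_eq] at hk hl
      have hmod : k % q = l % q := (ZMod.natCast_eq_natCast_iff' _ _ _).1 (hk.2.trans hl.2.symm)
      rw [← Nat.div_add_mod k q, ← Nat.div_add_mod l q, hmod, show k / q = l / q from hkl]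
  calc _ ≤ ((M / q + 1 : ℕ) : ℝ) := by exact_mod_cast h
    _ ≤ _ := by push_cast; gcongr; exact Nat.cast_div_le

section

variable {q : ℕ} [NeZero q]

theorem sum_convolution_residueCount_le (D : ℕ) :
    ∑ n : (ZMod q)ˣ, ∑ v, residueCount q D (n * v⁻¹) * residueCount q D v ≤ (D : ℝ) ^ 2 := by
  have htot : ∑ u : (ZMod q)ˣ, residueCount q D u ≤ D := by
    unfold residueCount
    rw [Finset.sum_comm]
    calc _ ≤ ∑ d ∈ Finset.Icc 1 D, (1 : ℝ) := Finset.sum_le_sum fun d _ => ?_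
      _ = D := by simp
    by_cases h : ∃ u : (ZMod q)ˣ, (d : ZMod q) = u
    · obtain ⟨u, hu⟩ := h
      simp [hu, Units.val_inj]
    · push Not at h
      simp [h]
  have h0 : 0 ≤ ∑ u : (ZMod q)ˣ, residueCount q D u :=
    Finset.sum_nonneg fun _ _ => residueCount_nonneg _ _ _
  rw [Finset.sum_comm]
  have : ∀ v : (ZMod q)ˣ, ∑ n : (ZMod q)ˣ, residueCount q D (n * v⁻¹) * residueCount q D v
      = (∑ u : (ZMod q)ˣ, residueCount q D u) * residueCount q D v := by
    intro v
    rw [← Finset.sum_mul, ← Equiv.sum_comp (Equiv.mulRight v⁻¹) (residueCount q D)]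
    rfl
  simp_rw [this]
  rw [← Finset.mul_sum, ← sq]
  gcongr

/-- The convolution at n counts pairs (d, e) with de ≡ n. The product de ≤ D² takes at most D²/q + 1
values in this class, each with at most B factorizations. -/
theorem convolution_residueCount_le {B : ℝ} (hB0 : 0 ≤ B) {D : ℕ}
    (hB : ∀ n : ℕ, n ≠ 0 → n ≤ D ^ 2 → (n.divisors.card : ℝ) ≤ B) (n : (ZMod q)ˣ) :
    ∑ v, residueCount q D (n * v⁻¹) * residueCount q D v ≤ B * ((D : ℝ) ^ 2 / q + 1) := by
  classical
  have hq : q ≠ 0 := NeZero.ne q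
  have h1 : ∑ v, residueCount q D (n * v⁻¹) * residueCount q D v
      ≤ ∑ d ∈ Finset.Icc 1 D, ∑ e ∈ Finset.Icc 1 D,
        if ((d * e : ℕ) : ZMod q) = n then (1 : ℝ) else 0 := by
    simp only [residueCount, Finset.sum_mul_sum]
    rw [Finset.sum_comm]
    refine Finset.sum_le_sum fun d _ => ?_
    rw [Finset.sum_comm]
    refine Finset.sum_le_sum fun e _ => ?_
    simp only [mul_ite, mul_one, mul_zero]
    by_cases h : ∃ v : (ZMod q)ˣ, (e : ZMod q) = v
    · obtain ⟨u, hu⟩ := h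
      have : ∀ v : (ZMod q)ˣ, (e : ZMod q) = v ↔ u = v := by
        intro v; rw [hu, Units.val_inj]
      simp only [this, Finset.sum_ite_eq, Finset.mem_univ, if_true]
      split_ifs with h1 h2 h2
      · exact le_rfl
      · refine absurd ?_ h2
        rw [Nat.cast_mul, h1, hu, ← Units.val_mul, inv_mul_cancel_right]
      · norm_num
      · exact le_rfl
    · push Not at h
      simp only [h, if_false, Finset.sum_const_zero]
      split_ifs <;> norm_num
  refine h1.trans ?_
  rw [← Finset.sum_product', Finset.sum_boole]
  have h2 : ((Finset.Icc 1 D ×ˢ Finset.Icc 1 D).filter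
        fun p : ℕ × ℕ => ((p.1 * p.2 : ℕ) : ZMod q) = n).card
      ≤ ∑ k ∈ (Finset.Icc 1 (D ^ 2)).filter (fun k : ℕ => (k : ZMod q) = n), k.divisors.card := by
    rw [Finset.card_eq_sum_card_fiberwise (f := fun p : ℕ × ℕ => p.1 * p.2)
      (t := (Finset.Icc 1 (D ^ 2)).filter (fun k : ℕ => (k : ZMod q) = n))]
    · refine Finset.sum_le_sum fun k hk => ?_
      have hk0 : k ≠ 0 := by
        have := (Finset.mem_Icc.1 (Finset.mem_filter.1 hk).1).1; omega
      refine Finset.card_le_card_of_injOn Prod.fst ?_ ?_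
      · intro p hp
        simp only [Finset.coe_filter, Finset.mem_filter, Set.mem_ofPred_eq] at hp
        exact Nat.mem_divisors.2 ⟨⟨p.2, hp.2.symm⟩, hk0⟩
      · intro p hp p' hp' h
        simp only [Finset.coe_filter, Finset.mem_filter, Set.mem_ofPred_eq] at hp hp'
        have h0 : p.1 ≠ 0 := by rintro h0; rw [h0, zero_mul] at hp; exact hk0 hp.2.symm
        refine Prod.ext h (Nat.eq_of_mul_eq_mul_left (Nat.pos_of_ne_zero h0) ?_)
        rw [hp.2, show p.1 = p'.1 from h, hp'.2]
    · intro p hp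
      simp only [Finset.coe_filter, Finset.mem_product, Finset.mem_Icc, Set.mem_ofPred_eq] at hp ⊢
      exact ⟨⟨Nat.mul_pos hp.1.1.1 hp.1.2.1, by rw [sq]; exact Nat.mul_le_mul hp.1.1.2 hp.1.2.2⟩,
        hp.2⟩
  calc _ ≤ ((∑ k ∈ (Finset.Icc 1 (D ^ 2)).filter (fun k : ℕ => (k : ZMod q) = n),
        k.divisors.card : ℕ) : ℝ) := by exact_mod_cast h2
    _ ≤ ∑ k ∈ (Finset.Icc 1 (D ^ 2)).filter (fun k : ℕ => (k : ZMod q) = n), B := by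
        push_cast
        refine Finset.sum_le_sum fun k hk => ?_
        have := Finset.mem_Icc.1 (Finset.mem_filter.1 hk).1
        exact hB k (by omega) this.2
    _ = B * _ := by rw [Finset.sum_const, nsmul_eq_mul, mul_comm]
    _ ≤ _ := by
        gcongr
        exact_mod_cast card_filter_modEq_le hq (D ^ 2) (n : ZMod q)

/-- One factor of the squared convolution is bounded pointwise; the other is summed to the total
mass D². -/
theorem energy_residueCount_le {B : ℝ} (hB0 : 0 ≤ B) {D : ℕ}
    (hB : ∀ n : ℕ, n ≠ 0 → n ≤ D ^ 2 → (n.divisors.card : ℝ) ≤ B) :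
    energy (residueCount q D) ≤ B * ((D : ℝ) ^ 2 / q + 1) * (D : ℝ) ^ 2 := by
  rw [energy_eq_sum_convolution]
  calc _ ≤ ∑ n : (ZMod q)ˣ, (B * ((D : ℝ) ^ 2 / q + 1)) *
        ∑ v, residueCount q D (n * v⁻¹) * residueCount q D v := by
        refine Finset.sum_le_sum fun n _ => ?_
        rw [sq]
        exact mul_le_mul_of_nonneg_right (convolution_residueCount_le hB0 hB n)
          (Finset.sum_nonneg fun _ _ =>
            mul_nonneg (residueCount_nonneg _ _ _) (residueCount_nonneg _ _ _))
    _ ≤ _ := by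
        rw [← Finset.mul_sum]
        exact mul_le_mul_of_nonneg_left (sum_convolution_residueCount_le D) (by positivity)

/-- Only the energy of g matters, so the same bound serves for the interval and for its image under
inversion. -/
theorem sum_sq_twisted_residueCount_le {B : ℝ} (hB1 : 1 ≤ B) {D H : ℕ}
    (hq : (q.divisors.card : ℝ) ≤ B)
    (hD : ∀ n : ℕ, n ≠ 0 → n ≤ D ^ 2 → (n.divisors.card : ℝ) ≤ B)
    (hH : ∀ n : ℕ, n ≠ 0 → n ≤ H ^ 2 → (n.divisors.card : ℝ) ≤ B)
    {g : (ZMod q)ˣ → ℝ} (hg : energy g = energy (residueCount q H)) :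
    ∑ b, (∑ u, residueCount q D u * g (u ^ 2 * b)) ^ 2
      ≤ 2 * B ^ 2 * (D * H * (1 + D / √q) * (1 + H / √q)) := by
  classical
  have hq0 : (0 : ℝ) < q := by exact_mod_cast Nat.pos_of_ne_zero (NeZero.ne q)
  have hB0 : 0 ≤ B := by linarith
  have h1 := sq_sum_sq_twisted_le (residueCount q D) g
  have h2 : ((Finset.univ.filter fun w : (ZMod q)ˣ => w ^ 2 = 1).card : ℝ) ≤ 2 * B := by
    calc _ ≤ ((2 * q.divisors.card : ℕ) : ℝ) := by exact_mod_cast card_sq_eq_one_le q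
      _ ≤ _ := by push_cast; linarith
  have hsq : ∀ t : ℝ, 0 ≤ t → t ^ 2 / q + 1 ≤ (1 + t / √q) ^ 2 := by
    intro t ht
    have : (t / √q) ^ 2 = t ^ 2 / q := by rw [div_pow, Real.sq_sqrt hq0.le]
    have : 0 ≤ t / √q := by positivity
    nlinarith
  refine (pow_le_pow_iff_left₀ (Finset.sum_nonneg fun _ _ => sq_nonneg _) (by positivity)
    two_ne_zero).1 (h1.trans ?_)
  rw [hg]
  calc _ ≤ (B * (1 + D / √q) ^ 2 * (D : ℝ) ^ 2) * (2 * B * (B * (1 + H / √q) ^ 2 * (H : ℝ) ^ 2)) := by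
        have e1 := (energy_residueCount_le (q := q) hB0 hD).trans (mul_le_mul_of_nonneg_right
          (mul_le_mul_of_nonneg_left (hsq D (by positivity)) hB0) (sq_nonneg _))
        have e2 := (energy_residueCount_le (q := q) hB0 hH).trans (mul_le_mul_of_nonneg_right
          (mul_le_mul_of_nonneg_left (hsq H (by positivity)) hB0) (sq_nonneg _))
        exact mul_le_mul e1 (mul_le_mul h2 e2 (energy_nonneg _) (by positivity))
          (mul_nonneg (by positivity) (energy_nonneg _)) (by positivity)
    _ = (2 * B ^ 3) * (D * H * (1 + D / √q) * (1 + H / √q)) ^ 2 := by ring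
    -- A power of B is wasted to obtain a perfect square.
    _ ≤ (4 * B ^ 4) * (D * H * (1 + D / √q) * (1 + H / √q)) ^ 2 := by
        refine mul_le_mul_of_nonneg_right ?_ (sq_nonneg _)
        have : B ^ 3 ≤ B ^ 4 := pow_le_pow_right₀ hB1 (by norm_num)
        have : 0 ≤ B ^ 3 := by positivity
        linarith
    _ = _ := by ring

theorem sum_le_sum_residueCount_mul {D : ℕ} {s : Finset ℕ}
    (hs : ∀ d ∈ s, d ∈ Finset.Icc 1 D ∧ d.Coprime q) {T : ℕ → ℝ} {F : (ZMod q)ˣ → ℝ}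
    (hF : ∀ u, 0 ≤ F u) (hT : ∀ d ∈ s, ∀ u : (ZMod q)ˣ, (d : ZMod q) = u → T d ≤ F u) :
    ∑ d ∈ s, T d ≤ ∑ u, residueCount q D u * F u := by
  unfold residueCount
  simp only [Finset.sum_mul]
  rw [Finset.sum_comm]
  have hnn : ∀ d : ℕ, 0 ≤ ∑ u : (ZMod q)ˣ, (if (d : ZMod q) = u then 1 else 0) * F u :=
    fun d => Finset.sum_nonneg fun u _ => by split_ifs <;> simp [hF]
  refine le_trans ?_ (Finset.sum_le_sum_of_subset_of_nonneg (fun d hd => (hs d hd).1)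
    fun d _ _ => hnn d)
  refine Finset.sum_le_sum fun d hd => ?_
  refine (hT d hd (ZMod.unitOfCoprime d (hs d hd).2) (by simp)).trans ?_
  refine le_trans (le_of_eq ?_) (Finset.single_le_sum (f := fun u : (ZMod q)ˣ =>
    (if (d : ZMod q) = u then 1 else 0) * F u)
    (fun u _ => by split_ifs <;> simp [hF]) (Finset.mem_univ (ZMod.unitOfCoprime d (hs d hd).2)))
  simp

section Count

variable {B : ℝ} (hB1 : 1 ≤ B) {D H : ℕ} (hq : (q.divisors.card : ℝ) ≤ B)
    (hD : ∀ n : ℕ, n ≠ 0 → n ≤ D ^ 2 → (n.divisors.card : ℝ) ≤ B)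
    (hH : ∀ n : ℕ, n ≠ 0 → n ≤ H ^ 2 → (n.divisors.card : ℝ) ≤ B)

include hB1 hq hD hH

/-- Second moment of the number of solutions of `d ^ 2 * m = a`. -/
theorem sum_sq_card_sq_mul_eq_le {s : Finset ℕ}
    (hs : ∀ d ∈ s, d ∈ Finset.Icc 1 D ∧ d.Coprime q) {M : ℕ → ℕ} (hM : ∀ d ∈ s, M d ≤ H) :
    ∑ a : (ZMod q)ˣ, (∑ d ∈ s, (((Finset.Icc 1 (M d)).filter
        fun m : ℕ => ((d ^ 2 * m : ℕ) : ZMod q) = a).card : ℝ)) ^ 2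
      ≤ 2 * B ^ 2 * (D * H * (1 + D / √q) * (1 + H / √q)) := by
  refine le_trans ?_ (sum_sq_twisted_residueCount_le hB1 hq hD hH
    (energy_comp_inv (residueCount q H)))
  -- With b = a⁻¹, the equation d²m = a says that m = (d²b)⁻¹, hence the inverted weight.
  rw [← Equiv.sum_comp (Equiv.inv (ZMod q)ˣ)]
  refine Finset.sum_le_sum fun b _ => ?_
  refine pow_le_pow_left₀ (by positivity) ?_ 2
  refine sum_le_sum_residueCount_mul hs (fun u => residueCount_nonneg _ _ _) fun d hd u hu => ?_
  rw [residueCount, Finset.sum_boole]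
  norm_cast
  refine Finset.card_le_card fun m hm => ?_
  simp only [Finset.mem_filter, Finset.mem_Icc, Equiv.inv_apply] at hm ⊢
  refine ⟨⟨hm.1.1, hm.1.2.trans (hM d hd)⟩, ?_⟩
  have h := hm.2
  push_cast at h
  rw [hu] at h
  rw [mul_inv, Units.val_mul, ← h, ← mul_assoc, ← Units.val_pow_eq_pow_val, ← Units.val_mul,
    inv_mul_cancel, Units.val_one, one_mul]

/-- Second moment of the number of `d` for which `d ^ 2 * b` has a small absolute residue. -/
theorem sum_sq_card_valMinAbs_le {s : (ZMod q)ˣ → Finset ℕ}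
    (hs : ∀ b, ∀ d ∈ s b, d ∈ Finset.Icc 1 D ∧ d.Coprime q)
    (hs' : ∀ b, ∀ d ∈ s b, ((d : ZMod q) ^ 2 * b).valMinAbs.natAbs ∈ Finset.Icc 1 H) :
    ∑ b : (ZMod q)ˣ, ((s b).card : ℝ) ^ 2
      ≤ 8 * B ^ 2 * (D * H * (1 + D / √q) * (1 + H / √q)) := by
  have h1 := sum_sq_twisted_residueCount_le hB1 hq hD hH (g := residueCount q H) rfl
  have h2 := h1
  rw [← Equiv.sum_comp (Equiv.neg (ZMod q)ˣ)] at h2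
  -- The least absolute residue may have either sign, so d²b or -d²b has a representative in [1, H].
  -- The two moments are equal after b ↦ -b.
  have h3 : ∀ b, ((s b).card : ℝ) ^ 2
      ≤ 2 * (∑ u, residueCount q D u * residueCount q H (u ^ 2 * b)) ^ 2
        + 2 * (∑ u, residueCount q D u * residueCount q H (u ^ 2 * (Equiv.neg _ b))) ^ 2 := by
    intro b
    have : ((s b).card : ℝ) ≤ ∑ u, residueCount q D u *
        (residueCount q H (u ^ 2 * b) + residueCount q H (u ^ 2 * (Equiv.neg _ b))) := by
      rw [Finset.card_eq_sum_ones, Nat.cast_sum]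
      refine sum_le_sum_residueCount_mul (hs b)
        (fun u => add_nonneg (residueCount_nonneg _ _ _) (residueCount_nonneg _ _ _))
        fun d hd u hu => ?_
      have hmem := hs' b d hd
      set z := (d : ZMod q) ^ 2 * b with hz
      have hz' : z = ((u ^ 2 * b : (ZMod q)ˣ) : ZMod q) := by rw [hz, hu]; simp
      have hone : ∀ v : (ZMod q)ˣ, ((z.valMinAbs.natAbs : ℕ) : ZMod q) = v →
          (1 : ℝ) ≤ residueCount q H v := by
        intro v hv
        refine le_trans (le_of_eq ?_) (Finset.single_le_sum
          (f := fun d : ℕ => if (d : ZMod q) = v then (1 : ℝ) else 0)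
          (fun _ _ => by split_ifs <;> norm_num) hmem)
        simp [hv]
      rw [Nat.cast_one]
      rcases Int.natAbs_eq z.valMinAbs with h | h
      · have := hone (u ^ 2 * b) (by
          have hc := ZMod.coe_valMinAbs z
          rw [h, Int.cast_natCast] at hc
          rw [hc, hz'])
        linarith [residueCount_nonneg q H (u ^ 2 * (Equiv.neg _ b))]
      · have := hone (u ^ 2 * (Equiv.neg _ b)) (by
          have hc := ZMod.coe_valMinAbs z
          rw [h, Int.cast_neg, Int.cast_natCast] at hc
          rw [Equiv.neg_apply, mul_neg, Units.val_neg, ← hz']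
          exact neg_eq_iff_eq_neg.1 hc)
        linarith [residueCount_nonneg q H (u ^ 2 * b)]
    have h4 := pow_le_pow_left₀ (by positivity) this 2
    refine h4.trans ?_
    simp only [mul_add, Finset.sum_add_distrib]
    nlinarith [sq_nonneg (∑ u, residueCount q D u * residueCount q H (u ^ 2 * b)
      - ∑ u, residueCount q D u * residueCount q H (u ^ 2 * (Equiv.neg _ b)))]
  calc _ ≤ _ := Finset.sum_le_sum fun b _ => h3 b
    _ ≤ _ := by
      rw [Finset.sum_add_distrib, ← Finset.mul_sum, ← Finset.mul_sum]
      linarith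

end Count

end

/-! ### Linear exponential sums. -/

/-- The exponential sum `∑_{1 ≤ m ≤ M} e(m t)`. -/
noncomputable def expSum (M : ℕ) (t : ℝ) : ℂ :=
  ∑ m ∈ Finset.Icc 1 M, Complex.exp (2 * Real.pi * Complex.I * t) ^ m

theorem norm_exp_two_pi_I_mul (t : ℝ) : ‖Complex.exp (2 * Real.pi * Complex.I * t)‖ = 1 := by
  have : (2 * Real.pi * Complex.I * t : ℂ) = ((2 * Real.pi * t : ℝ) : ℂ) * Complex.I := by
    push_cast; ring
  rw [this, Complex.norm_exp_ofReal_mul_I]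

theorem norm_expSum_le (M : ℕ) (t : ℝ) : ‖expSum M t‖ ≤ M := by
  refine (norm_sum_le _ _).trans ?_
  simp [norm_pow, norm_exp_two_pi_I_mul]

theorem expSum_add_int (M : ℕ) (t : ℝ) (k : ℤ) : expSum M (t + k) = expSum M t := by
  unfold expSum
  have : Complex.exp (2 * Real.pi * Complex.I * ((t + k : ℝ) : ℂ))
      = Complex.exp (2 * Real.pi * Complex.I * t) := by
    rw [Complex.exp_eq_exp_iff_exists_int]
    exact ⟨k, by push_cast; ring⟩
  rw [this]

/-- Geometric series: the numerator is at most 2, and |z - 1| = 2|sin πt| ≥ 4|t| by Jordan's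
inequality. -/
theorem norm_expSum_le_inv (M : ℕ) {t : ℝ} (ht0 : t ≠ 0) (ht : |t| ≤ 1 / 2) :
    ‖expSum M t‖ ≤ 1 / |t| := by
  set z := Complex.exp (2 * Real.pi * Complex.I * t) with hz
  have hz1 : ‖z‖ = 1 := norm_exp_two_pi_I_mul t
  have hpi := Real.pi_pos
  have habs : 0 < |t| := abs_pos.2 ht0
  have hlow : 4 * |t| ≤ ‖z - 1‖ := by
    have : (2 * Real.pi * Complex.I * t : ℂ) = Complex.I * ((2 * Real.pi * t : ℝ) : ℂ) := by
      push_cast; ring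
    rw [hz, this, Complex.norm_exp_I_mul_ofReal_sub_one, Real.norm_eq_abs, abs_mul,
      abs_of_pos (two_pos : (0 : ℝ) < 2), show 2 * Real.pi * t / 2 = Real.pi * t by ring]
    have h1 : |Real.pi * t| ≤ Real.pi / 2 := by
      rw [abs_mul, abs_of_pos hpi]; nlinarith
    have h2 := Real.mul_abs_le_abs_sin h1
    rw [abs_mul, abs_of_pos hpi] at h2
    have : 2 / Real.pi * (Real.pi * |t|) = 2 * |t| := by field_simp
    linarith
  have hne : z ≠ 1 := by
    intro h; rw [h, sub_self, norm_zero] at hlow; linarith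
  have hsum : expSum M t = (z ^ (M + 1) - z ^ 1) / (z - 1) := by
    rw [← geom_sum_Ico hne (Nat.le_add_left 1 M)]; rfl
  rw [hsum, norm_div]
  have hnum : ‖z ^ (M + 1) - z ^ 1‖ ≤ 2 := by
    refine (norm_sub_le _ _).trans ?_
    rw [norm_pow, norm_pow, hz1]; norm_num
  calc _ ≤ 2 / (4 * |t|) := by gcongr
    _ ≤ 4 / (4 * |t|) := by gcongr; norm_num
    _ = 1 / |t| := by rw [mul_comm, ← div_div]; field_simp

theorem norm_expSum_div_le {q : ℕ} [NeZero q] (M n : ℕ) (hn : (n : ZMod q) ≠ 0) :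
    ‖expSum M (n / q)‖ ≤ q / ((n : ZMod q).valMinAbs.natAbs : ℝ) := by
  have hq : (0 : ℝ) < q := by exact_mod_cast Nat.pos_of_ne_zero (NeZero.ne q)
  set h := (n : ZMod q).valMinAbs with hh
  have hh0 : h ≠ 0 := by rwa [hh, Ne, ZMod.valMinAbs_eq_zero]
  have hcong : ((n : ℤ) : ZMod q) = (h : ZMod q) := by rw [hh, ZMod.coe_valMinAbs]; simp
  rw [ZMod.intCast_eq_intCast_iff_dvd_sub] at hcong
  obtain ⟨k, hk⟩ := hcong
  have hnk : (n : ℝ) / q = h / q + ((-k : ℤ) : ℝ) := by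
    have : (h : ℝ) - n = q * k := by exact_mod_cast hk
    field_simp
    push_cast
    linarith
  have hle : |(h : ℝ) / q| ≤ 1 / 2 := by
    rw [abs_div, abs_of_pos hq, div_le_div_iff₀ hq two_pos, one_mul]
    have h1 : h.natAbs * 2 ≤ q := by
      have := ZMod.natAbs_valMinAbs_le (n : ZMod q)
      rw [← hh] at this; omega
    have h2 : ((h.natAbs : ℕ) : ℝ) * 2 ≤ q := by exact_mod_cast h1
    rwa [Nat.cast_natAbs, Int.cast_abs] at h2
  rw [hnk, expSum_add_int]
  refine (norm_expSum_le_inv M (by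
    have : (h : ℝ) ≠ 0 := by exact_mod_cast hh0
    positivity) hle).trans (le_of_eq ?_)
  rw [abs_div, abs_of_pos hq, one_div_div, Nat.cast_natAbs, Int.cast_abs]

theorem stdAddChar_natCast {q : ℕ} [NeZero q] (n : ℕ) :
    ZMod.stdAddChar (n : ZMod q) = Complex.exp (2 * Real.pi * Complex.I * ((n / q : ℝ) : ℂ)) := by
  have := ZMod.stdAddChar_coe (N := q) (n : ℤ)
  rw [Int.cast_natCast] at this
  rw [this]
  congr 1
  push_cast
  ring

theorem sum_stdAddChar_eq_expSum {q : ℕ} [NeZero q] (M n : ℕ) :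
    ∑ m ∈ Finset.Icc 1 M, ZMod.stdAddChar ((m * n : ℕ) : ZMod q) = expSum M (n / q) := by
  refine Finset.sum_congr rfl fun m _ => ?_
  rw [← stdAddChar_natCast, ← AddChar.map_nsmul_eq_pow]
  congr 1
  push_cast
  rw [nsmul_eq_mul]

/-! ### Parseval on ℤ/q and reduction to primitive frequencies. -/

section

variable {q : ℕ} [NeZero q]

theorem sum_sq_eq_sum_norm_sq_fourier (P : ZMod q → ℝ) :
    (q : ℝ) * ∑ a, P a ^ 2 = ∑ b, ‖∑ a, (P a : ℂ) * ZMod.stdAddChar (a * b)‖ ^ 2 := by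
  have key : ∀ b : ZMod q, ((‖∑ a, (P a : ℂ) * ZMod.stdAddChar (a * b)‖ ^ 2 : ℝ) : ℂ)
      = ∑ a, ∑ a', (P a * P a' : ℂ) * ZMod.stdAddChar (b * (a - a')) := by
    intro b
    rw [Complex.ofReal_pow, ← Complex.mul_conj', map_sum, Finset.sum_mul_sum]
    refine Finset.sum_congr rfl fun a _ => Finset.sum_congr rfl fun a' _ => ?_
    rw [map_mul (starRingEnd ℂ), Complex.conj_ofReal, ← AddChar.map_neg_eq_conj,
      show b * (a - a') = a * b + -(a' * b) by ring, AddChar.map_add_eq_mul]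
    ring
  apply Complex.ofReal_injective
  rw [Complex.ofReal_sum, Finset.sum_congr rfl fun b _ => key b, Finset.sum_comm]
  push_cast
  rw [Finset.mul_sum]
  refine Finset.sum_congr rfl fun a _ => ?_
  rw [Finset.sum_comm]
  simp_rw [← Finset.mul_sum, AddChar.sum_mulShift _ (ZMod.isPrimitive_stdAddChar q), sub_eq_zero]
  simp only [ZMod.card, Nat.cast_ite, Nat.cast_zero, mul_ite, mul_zero, Finset.sum_ite_eq,
    Finset.mem_univ, if_true]
  ring

/-- The number of `m ≤ M` with `d ^ 2 * m = a`. -/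
noncomputable def sqMulCount (q M d : ℕ) (a : ZMod q) : ℝ :=
  (((Finset.Icc 1 M).filter fun m : ℕ => ((d ^ 2 * m : ℕ) : ZMod q) = a).card : ℝ)

theorem fourier_sqMulCount_sub (M d b : ℕ) (hb : (b : ZMod q) ≠ 0) :
    ∑ a : ZMod q, ((sqMulCount q M d a - M / q : ℝ) : ℂ) * ZMod.stdAddChar (a * (b : ZMod q))
      = expSum M ((d ^ 2 * b : ℕ) / q) := by
  have h0 : ∑ a : ZMod q, ZMod.stdAddChar (a * (b : ZMod q)) = (0 : ℂ) := by
    rw [AddChar.sum_mulShift _ (ZMod.isPrimitive_stdAddChar q), if_neg hb, Nat.cast_zero]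
  simp only [Complex.ofReal_sub, sub_mul, Finset.sum_sub_distrib]
  rw [← Finset.mul_sum, h0, mul_zero, sub_zero, ← sum_stdAddChar_eq_expSum]
  have : ∀ a : ZMod q, (sqMulCount q M d a : ℂ)
      = ∑ m ∈ Finset.Icc 1 M, if ((d ^ 2 * m : ℕ) : ZMod q) = a then (1 : ℂ) else 0 := by
    intro a; rw [Finset.sum_boole, sqMulCount]; push_cast; rfl
  simp_rw [this, Finset.sum_mul]
  rw [Finset.sum_comm]
  refine Finset.sum_congr rfl fun m _ => ?_
  simp only [ite_mul, one_mul, zero_mul, Finset.sum_ite_eq, Finset.mem_univ, if_true]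
  congr 1
  push_cast
  ring

theorem sum_sqMulCount (M d : ℕ) : ∑ a : ZMod q, sqMulCount q M d a = M := by
  simp only [sqMulCount]
  have := Finset.card_eq_sum_card_fiberwise (s := Finset.Icc 1 M) (t := (Finset.univ : Finset (ZMod q)))
    (f := fun m : ℕ => ((d ^ 2 * m : ℕ) : ZMod q)) (fun _ _ => by simp)
  rw [Nat.card_Icc, Nat.add_sub_cancel] at this
  exact_mod_cast this.symm

/-- Parseval. The frequency 0 drops out since M/q is the exact mean of `sqMulCount`; at other
frequencies the constant drops out instead and an exponential sum remains. -/
theorem sum_sq_sqMulCount_sub_le (s : Finset ℕ) (M : ℕ → ℕ) (ν : ℕ → ℝ) (hν : ∀ d, |ν d| ≤ 1) :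
    (q : ℝ) * ∑ a : ZMod q, (∑ d ∈ s, ν d * (sqMulCount q (M d) d a - M d / q)) ^ 2
      ≤ ∑ b ∈ (Finset.range q).erase 0, (∑ d ∈ s, ‖expSum (M d) ((d ^ 2 * b : ℕ) / q)‖) ^ 2 := by
  have hq : (q : ℝ) ≠ 0 := by exact_mod_cast NeZero.ne q
  rw [sum_sq_eq_sum_norm_sq_fourier]
  have hzero : ∑ a : ZMod q, ((∑ d ∈ s, ν d * (sqMulCount q (M d) d a - M d / q) : ℝ) : ℂ)
      * ZMod.stdAddChar (a * (0 : ZMod q)) = 0 := by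
    simp only [mul_zero, AddChar.map_zero_eq_one, mul_one]
    rw [← Complex.ofReal_sum, Finset.sum_comm]
    simp only [← Finset.mul_sum, Finset.sum_sub_distrib, sum_sqMulCount, Finset.sum_const,
      Finset.card_univ, ZMod.card, nsmul_eq_mul, mul_div_cancel₀ _ hq, sub_self, mul_zero,
      Complex.ofReal_zero]
  have hreindex : ∀ f : ZMod q → ℝ, ∑ b, f b = ∑ b ∈ Finset.range q, f (b : ZMod q) := by
    intro f
    refine Finset.sum_bij' (fun b _ => b.val) (fun b _ => (b : ZMod q)) ?_ ?_ ?_ ?_ ?_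
    · intro b _; exact Finset.mem_range.2 (ZMod.val_lt b)
    · intro b _; exact Finset.mem_univ _
    · intro b _; exact ZMod.natCast_zmod_val b
    · intro b hb; exact ZMod.val_cast_of_lt (Finset.mem_range.1 hb)
    · intro b _; rw [ZMod.natCast_zmod_val]
  rw [hreindex, ← Finset.add_sum_erase _ _ (Finset.mem_range.2 (Nat.pos_of_ne_zero (NeZero.ne q))),
    Nat.cast_zero, hzero, norm_zero, zero_pow two_ne_zero, zero_add]
  refine Finset.sum_le_sum fun b hb => ?_
  have hb0 : (b : ZMod q) ≠ 0 := by
    rw [Ne, ZMod.natCast_eq_zero_iff]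
    simp only [Finset.mem_erase, Finset.mem_range] at hb
    exact Nat.not_dvd_of_pos_of_lt (Nat.pos_of_ne_zero hb.1) hb.2
  refine pow_le_pow_left₀ (norm_nonneg _) ?_ 2
  have : ∑ a : ZMod q, ((∑ d ∈ s, ν d * (sqMulCount q (M d) d a - M d / q) : ℝ) : ℂ)
      * ZMod.stdAddChar (a * (b : ZMod q))
      = ∑ d ∈ s, (ν d : ℂ) * expSum (M d) ((d ^ 2 * b : ℕ) / q) := by
    simp only [Complex.ofReal_sum, Finset.sum_mul]
    rw [Finset.sum_comm]
    refine Finset.sum_congr rfl fun d _ => ?_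
    rw [← fourier_sqMulCount_sub _ _ _ hb0, Finset.mul_sum]
    refine Finset.sum_congr rfl fun a _ => ?_
    rw [Complex.ofReal_mul, mul_assoc]
  rw [this]
  refine (norm_sum_le _ _).trans (Finset.sum_le_sum fun d _ => ?_)
  rw [norm_mul, Complex.norm_real, Real.norm_eq_abs]
  exact mul_le_of_le_one_left (norm_nonneg _) (hν d)

/-- Sorting the nonzero fractions with denominator `q` by their reduced denominator. -/
theorem sum_range_erase_zero_eq_sum_divisors (q : ℕ) (hq : q ≠ 0) (F : ℝ → ℝ) :
    ∑ b ∈ (Finset.range q).erase 0, F (b / q)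
      = ∑ r ∈ q.divisors.erase 1, ∑ b ∈ (Finset.range r).filter (fun b => b.Coprime r), F (b / r) := by
  have hmaps : ∀ b ∈ (Finset.range q).erase 0, q / Nat.gcd b q ∈ q.divisors.erase 1 := by
    intro b hb
    simp only [Finset.mem_erase, Finset.mem_range, Nat.mem_divisors] at hb ⊢
    refine ⟨?_, Nat.div_dvd_of_dvd (Nat.gcd_dvd_right b q), hq⟩
    intro h
    have h1 : q = Nat.gcd b q := by
      have := Nat.div_mul_cancel (Nat.gcd_dvd_right b q)
      rw [h, one_mul] at this; exact this.symm
    have : q ∣ b := h1 ▸ Nat.gcd_dvd_left b q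
    exact Nat.not_dvd_of_pos_of_lt (Nat.pos_of_ne_zero hb.1) hb.2 this
  rw [← Finset.sum_fiberwise_of_maps_to hmaps]
  refine Finset.sum_congr rfl fun r hr => ?_
  simp only [Finset.mem_erase, Nat.mem_divisors] at hr
  obtain ⟨hr1, ⟨e, rfl⟩, -⟩ := hr
  have hr0 : 0 < r := Nat.pos_of_ne_zero fun h => hq (by rw [h, zero_mul])
  have he0 : 0 < e := Nat.pos_of_ne_zero fun h => hq (by rw [h, mul_zero])
  symm
  refine Finset.sum_bij (fun b _ => b * e) ?_ ?_ ?_ ?_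
  · intro b hb
    simp only [Finset.mem_filter, Finset.mem_range, Finset.mem_erase] at hb ⊢
    have hb0 : b ≠ 0 := by
      rintro rfl; exact hr1 ((Nat.coprime_zero_left r).1 hb.2)
    refine ⟨⟨(Nat.mul_pos (Nat.pos_of_ne_zero hb0) he0).ne', Nat.mul_lt_mul_of_pos_right hb.1 he0⟩, ?_⟩
    rw [Nat.gcd_mul_right, hb.2.gcd_eq_one, one_mul, Nat.mul_div_cancel _ he0]
  · intro b _ b' _ h
    exact Nat.eq_of_mul_eq_mul_right he0 h
  · intro b hb
    simp only [Finset.mem_filter, Finset.mem_range, Finset.mem_erase] at hb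
    have hg : Nat.gcd b (r * e) = e := by
      have := Nat.div_mul_cancel (Nat.gcd_dvd_right b (r * e))
      rw [hb.2] at this
      exact Nat.eq_of_mul_eq_mul_left hr0 this
    have hd : e ∣ b := by
      have := Nat.gcd_dvd_left b (r * e)
      rwa [hg] at this
    obtain ⟨c, rfl⟩ := hd
    refine ⟨c, ?_, mul_comm _ _⟩
    simp only [Finset.mem_filter, Finset.mem_range]
    refine ⟨?_, ?_⟩
    · have := hb.1.2
      rw [mul_comm r e] at this
      exact Nat.lt_of_mul_lt_mul_left this
    · rw [mul_comm r e, Nat.gcd_mul_left] at hg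
      exact Nat.eq_of_mul_eq_mul_left he0 (hg.trans (mul_one e).symm)
  · intro b _
    congr 1
    have : (e : ℝ) ≠ 0 := by exact_mod_cast he0.ne'
    push_cast
    rw [mul_div_mul_right _ _ this]

theorem sum_range_coprime_eq_sum_units (F : ℕ → ℝ) :
    ∑ b ∈ (Finset.range q).filter (fun b => b.Coprime q), F b
      = ∑ u : (ZMod q)ˣ, F (u : ZMod q).val := by
  symm
  refine Finset.sum_bij (fun u _ => (u : ZMod q).val) ?_ ?_ ?_ ?_
  · intro u _
    simp only [Finset.mem_filter, Finset.mem_range]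
    exact ⟨ZMod.val_lt _, ZMod.val_coe_unit_coprime u⟩
  · intro u _ v _ h
    exact Units.ext (ZMod.val_injective q h)
  · intro b hb
    simp only [Finset.mem_filter, Finset.mem_range] at hb
    refine ⟨ZMod.unitOfCoprime b hb.2, Finset.mem_univ _, ?_⟩
    rw [ZMod.coe_unitOfCoprime, ZMod.val_cast_of_lt hb.1]
  · intro u _; rfl

end

/-! ### Dyadic decomposition of the small and large ranges. -/

theorem sq_sum_fiberwise_le {ι κ : Type*} [DecidableEq κ] (s : Finset ι) (T : Finset κ)
    (c : ι → κ) (hc : ∀ d ∈ s, c d ∈ T) (f : ι → ℝ) (hf : ∀ d ∈ s, 0 ≤ f d) (W : κ → ℝ)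
    (hW : ∀ d ∈ s, f d ≤ W (c d)) :
    (∑ d ∈ s, f d) ^ 2
      ≤ T.card * ∑ p ∈ T, W p ^ 2 * ((s.filter fun d => c d = p).card : ℝ) ^ 2 := by
  rw [← Finset.sum_fiberwise_of_maps_to hc]
  refine sq_sum_le_card_mul_sum_sq.trans ?_
  refine mul_le_mul_of_nonneg_left (Finset.sum_le_sum fun p _ => ?_) (by positivity)
  rw [← mul_pow]
  refine pow_le_pow_left₀ (Finset.sum_nonneg fun d hd => hf d (Finset.mem_filter.1 hd).1) ?_ 2
  rw [mul_comm, ← nsmul_eq_mul]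
  refine Finset.sum_le_card_nsmul _ _ _ fun d hd => ?_
  rw [Finset.mem_filter] at hd
  exact hd.2 ▸ hW d hd.1

section

variable {q : ℕ} [NeZero q]

/-- Sort d by the dyadic sizes 2^i of d and 2^j of the absolute residue of d²u. On a cell the
exponential sum is at most min(N/4^i, q/2^j), and `sum_sq_card_valMinAbs_le` bounds the second
moment of the cell's cardinality. The hypothesis on R lists what holds for D = 2^(i+1), H = 2^(j+1)
and this weight W. At most K² cells occur, and Cauchy–Schwarz over them costs K⁴. -/
theorem sum_units_sq_sum_expSum_le (hq1 : q ≠ 1) {B R : ℝ} (hB1 : 1 ≤ B) {N K D₀ : ℕ}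
    (hB : ∀ n : ℕ, n ≠ 0 → n ≤ 4 * D₀ ^ 2 + 4 * q ^ 2 → (n.divisors.card : ℝ) ≤ B)
    (hKD : D₀ < 2 ^ K) (hKq : q < 2 ^ K) {s : Finset ℕ}
    (hs : ∀ d ∈ s, d ∈ Finset.Icc 1 D₀ ∧ d.Coprime q)
    (hR0 : 0 ≤ R)
    (hR : ∀ D H W : ℝ, 2 ≤ D → D ≤ 2 * D₀ → 2 ≤ H → 0 ≤ W → W * D ^ 2 ≤ 4 * N → W * H ≤ 2 * q →
      W ^ 2 * (D * H * (1 + D / √q) * (1 + H / √q)) ≤ R) :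
    ∑ u : (ZMod q)ˣ, (∑ d ∈ s, ‖expSum (N / d ^ 2) (d ^ 2 * ((u : ZMod q).val / q))‖) ^ 2
      ≤ 8 * B ^ 2 * K ^ 4 * R := by
  classical
  have hq0 : 0 < q := Nat.pos_of_ne_zero (NeZero.ne q)
  have hnt : Nontrivial (ZMod q) := ZMod.nontrivial_iff.2 hq1
  set h : (ZMod q)ˣ → ℕ → ℕ := fun u d => ((d : ZMod q) ^ 2 * u).valMinAbs.natAbs with hh
  have hne : ∀ u : (ZMod q)ˣ, ∀ d ∈ s, (d : ZMod q) ^ 2 * u ≠ 0 := by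
    intro u d hd
    have h1 : IsUnit (d : ZMod q) := (ZMod.isUnit_iff_coprime d q).2 (hs d hd).2
    exact ((h1.pow 2).mul u.isUnit).ne_zero
  have hpos : ∀ u : (ZMod q)ˣ, ∀ d ∈ s, h u d ≠ 0 := by
    intro u d hd
    rw [hh, Ne, Int.natAbs_eq_zero, ZMod.valMinAbs_eq_zero]
    exact hne u d hd
  have hleq : ∀ u d, h u d ≤ q := fun u d =>
    (ZMod.natAbs_valMinAbs_le _).trans (Nat.div_le_self _ _)
  set T : Finset (ℕ × ℕ) := (Finset.range K ×ˢ Finset.range K).filter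
    fun p => 2 ^ p.1 ≤ D₀ ∧ 2 ^ p.2 ≤ q with hT
  have hTcard : (T.card : ℝ) ≤ (K : ℝ) ^ 2 := by
    have : T.card ≤ K ^ 2 := by
      refine (Finset.card_filter_le _ _).trans (le_of_eq ?_)
      rw [Finset.card_product, Finset.card_range, sq]
    exact_mod_cast this
  set W : ℕ × ℕ → ℝ := fun p => min (N / 4 ^ p.1) (q / 2 ^ p.2) with hW
  have hW0 : ∀ p, 0 ≤ W p := fun p => le_min (by positivity) (by positivity)
  set c : (ZMod q)ˣ → ℕ → ℕ × ℕ := fun u d => (Nat.log 2 d, Nat.log 2 (h u d)) with hc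
  have hcT : ∀ u, ∀ d ∈ s, c u d ∈ T := by
    intro u d hd
    have hd1 := Finset.mem_Icc.1 (hs d hd).1
    have e1 : 2 ^ Nat.log 2 d ≤ D₀ := (Nat.pow_log_le_self 2 (by omega)).trans hd1.2
    have e2 : 2 ^ Nat.log 2 (h u d) ≤ q := (Nat.pow_log_le_self 2 (hpos u d hd)).trans (hleq u d)
    simp only [hT, hc, Finset.mem_filter, Finset.mem_product, Finset.mem_range]
    exact ⟨⟨(Nat.pow_lt_pow_iff_right one_lt_two).1 (e1.trans_lt hKD),
      (Nat.pow_lt_pow_iff_right one_lt_two).1 (e2.trans_lt hKq)⟩, e1, e2⟩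
  have hterm : ∀ u : (ZMod q)ˣ, ∀ d ∈ s,
      ‖expSum (N / d ^ 2) (d ^ 2 * ((u : ZMod q).val / q))‖ ≤ W (c u d) := by
    intro u d hd
    have hd1 := Finset.mem_Icc.1 (hs d hd).1
    refine le_min ?_ ?_
    · refine (norm_expSum_le _ _).trans (Nat.cast_div_le.trans ?_)
      have : (4 : ℝ) ^ (c u d).1 ≤ (d : ℝ) ^ 2 := by
        have h1 : 2 ^ Nat.log 2 d ≤ d := Nat.pow_log_le_self 2 (by omega)
        have h2 : ((2 : ℝ) ^ Nat.log 2 d) ≤ d := by exact_mod_cast h1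
        calc (4 : ℝ) ^ (c u d).1 = ((2 : ℝ) ^ Nat.log 2 d) ^ 2 := by
              rw [← pow_mul, mul_comm, pow_mul]; norm_num [hc]
          _ ≤ _ := by gcongr
      push_cast
      gcongr
    · have hcast : (((d ^ 2 * (u : ZMod q).val : ℕ) : ZMod q)) = (d : ZMod q) ^ 2 * u := by
        push_cast; rw [ZMod.natCast_zmod_val]
      have h1 := norm_expSum_div_le (q := q) (N / d ^ 2) (d ^ 2 * (u : ZMod q).val)
        (by rw [hcast]; exact hne u d hd)
      rw [hcast] at h1
      have h2 : (d : ℝ) ^ 2 * ((u : ZMod q).val / q) = ((d ^ 2 * (u : ZMod q).val : ℕ) : ℝ) / q := by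
        push_cast; ring
      rw [h2]
      refine h1.trans ?_
      have h3 : 2 ^ Nat.log 2 (h u d) ≤ h u d := Nat.pow_log_le_self 2 (hpos u d hd)
      have h4 : ((2 : ℝ) ^ Nat.log 2 (h u d)) ≤ h u d := by exact_mod_cast h3
      exact div_le_div_of_nonneg_left (by positivity) (by positivity) h4
  have hmain : ∀ p ∈ T, ∑ u : (ZMod q)ˣ, W p ^ 2 * ((s.filter fun d => c u d = p).card : ℝ) ^ 2
      ≤ 8 * B ^ 2 * R := by
    intro p hp
    simp only [hT, Finset.mem_filter] at hp
    have hpD : 2 ^ (p.1 + 1) ≤ 2 * D₀ := by rw [pow_succ]; omega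
    have hpq : 2 ^ (p.2 + 1) ≤ 2 * q := by rw [pow_succ]; omega
    rw [← Finset.mul_sum]
    have hcount := sum_sq_card_valMinAbs_le (q := q) hB1 (D := 2 ^ (p.1 + 1)) (H := 2 ^ (p.2 + 1))
      (hB q hq0.ne' (by nlinarith))
      (fun n hn hle => hB n hn (hle.trans (by nlinarith [Nat.pow_le_pow_left hpD 2])))
      (fun n hn hle => hB n hn (hle.trans (by nlinarith [Nat.pow_le_pow_left hpq 2])))
      (s := fun u => s.filter fun d => c u d = p) ?_ ?_
    · have hRp := hR (2 ^ (p.1 + 1)) (2 ^ (p.2 + 1)) (W p) (le_self_pow₀ one_le_two (by omega))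
        (by exact_mod_cast hpD) (le_self_pow₀ one_le_two (by omega)) (hW0 p) ?_ ?_
      · push_cast at hcount
        calc _ ≤ W p ^ 2 * _ := mul_le_mul_of_nonneg_left hcount (sq_nonneg _)
          _ = 8 * B ^ 2 * (W p ^ 2 * (2 ^ (p.1 + 1) * 2 ^ (p.2 + 1) * (1 + 2 ^ (p.1 + 1) / √q)
                * (1 + 2 ^ (p.2 + 1) / √q))) := by ring
          _ ≤ _ := by gcongr
      · have h4 : ((2 : ℝ) ^ (p.1 + 1)) ^ 2 = 4 * 4 ^ p.1 := by
          rw [← pow_mul, mul_comm, pow_mul]; norm_num [pow_succ]; ring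
        calc W p * ((2 : ℝ) ^ (p.1 + 1)) ^ 2 ≤ N / 4 ^ p.1 * (4 * 4 ^ p.1) := by
              rw [h4]; exact mul_le_mul_of_nonneg_right (min_le_left _ _) (by positivity)
          _ = 4 * N := by field_simp
      · calc W p * (2 : ℝ) ^ (p.2 + 1) ≤ q / 2 ^ p.2 * 2 ^ (p.2 + 1) :=
              mul_le_mul_of_nonneg_right (min_le_right _ _) (by positivity)
          _ = 2 * q := by rw [pow_succ]; field_simp
    · intro u d hd
      simp only [Finset.mem_filter] at hd
      have hd1 := Finset.mem_Icc.1 (hs d hd.1).1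
      refine ⟨Finset.mem_Icc.2 ⟨hd1.1, ?_⟩, (hs d hd.1).2⟩
      rw [← hd.2]
      exact (Nat.lt_pow_succ_log_self one_lt_two d).le
    · intro u d hd
      simp only [Finset.mem_filter] at hd
      refine Finset.mem_Icc.2 ⟨Nat.pos_of_ne_zero (hpos u d hd.1), ?_⟩
      rw [← hd.2]
      exact (Nat.lt_pow_succ_log_self one_lt_two (h u d)).le
  calc _ ≤ ∑ u : (ZMod q)ˣ, (K : ℝ) ^ 2 *
        ∑ p ∈ T, W p ^ 2 * ((s.filter fun d => c u d = p).card : ℝ) ^ 2 := by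
        refine Finset.sum_le_sum fun u _ => ?_
        refine (sq_sum_fiberwise_le s T (c u) (hcT u) _ (fun _ _ => norm_nonneg _) W
          (hterm u)).trans ?_
        exact mul_le_mul_of_nonneg_right hTcard (Finset.sum_nonneg fun _ _ => by positivity)
    _ = (K : ℝ) ^ 2 * ∑ p ∈ T, ∑ u : (ZMod q)ˣ,
          W p ^ 2 * ((s.filter fun d => c u d = p).card : ℝ) ^ 2 := by
        rw [← Finset.mul_sum, Finset.sum_comm]
    _ ≤ (K : ℝ) ^ 2 * (T.card * (8 * B ^ 2 * R)) := by
        refine mul_le_mul_of_nonneg_left ?_ (by positivity)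
        rw [← nsmul_eq_mul]
        exact Finset.sum_le_card_nsmul _ _ _ hmain
    _ ≤ (K : ℝ) ^ 2 * ((K : ℝ) ^ 2 * (8 * B ^ 2 * R)) := by gcongr
    _ = _ := by ring

/-- The frequencies b/q are regrouped by reduced denominator r ∣ q, so that each group runs over
units modulo r, where the energy bound applies; there are at most B groups. -/
theorem sum_sq_small_sqMulCount_le {B R : ℝ} (hB1 : 1 ≤ B) (hR0 : 0 ≤ R) {N K D₀ : ℕ}
    (hB : ∀ n : ℕ, n ≠ 0 → n ≤ 4 * D₀ ^ 2 + 4 * q ^ 2 → (n.divisors.card : ℝ) ≤ B)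
    (hKD : D₀ < 2 ^ K) (hKq : q < 2 ^ K) {s : Finset ℕ}
    (hs : ∀ d ∈ s, d ∈ Finset.Icc 1 D₀ ∧ d.Coprime q) (ν : ℕ → ℝ) (hν : ∀ d, |ν d| ≤ 1)
    (hR : ∀ r : ℕ, 1 ≤ r → r ≤ q → ∀ D H W : ℝ, 2 ≤ D → D ≤ 2 * D₀ → 2 ≤ H → 0 ≤ W →
      W * D ^ 2 ≤ 4 * N → W * H ≤ 2 * r → W ^ 2 * (D * H * (1 + D / √r) * (1 + H / √r)) ≤ R) :
    (q : ℝ) * ∑ a : ZMod q,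
        (∑ d ∈ s, ν d * (sqMulCount q (N / d ^ 2) d a - ((N / d ^ 2 : ℕ) : ℝ) / q)) ^ 2
      ≤ 8 * B ^ 3 * K ^ 4 * R := by
  have hq0 : q ≠ 0 := NeZero.ne q
  refine (sum_sq_sqMulCount_sub_le s (fun d => N / d ^ 2) ν hν).trans ?_
  have e1 := sum_range_erase_zero_eq_sum_divisors q hq0
    (fun t => (∑ d ∈ s, ‖expSum (N / d ^ 2) (d ^ 2 * t)‖) ^ 2)
  have e2 : ∀ b d : ℕ, ((d ^ 2 * b : ℕ) : ℝ) / q = (d : ℝ) ^ 2 * (b / q) := by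
    intro b d; push_cast; ring
  simp only [e2]
  rw [e1]
  have e3 : ∀ r ∈ q.divisors.erase 1, ∑ b ∈ (Finset.range r).filter (fun b => b.Coprime r),
      (∑ d ∈ s, ‖expSum (N / d ^ 2) (d ^ 2 * ((b : ℝ) / r))‖) ^ 2 ≤ 8 * B ^ 2 * K ^ 4 * R := by
    intro r hr
    simp only [Finset.mem_erase, Nat.mem_divisors] at hr
    have hr0 : r ≠ 0 := fun h => hq0 (by simpa [h] using hr.2.1)
    have : NeZero r := ⟨hr0⟩
    have hrq : r ≤ q := Nat.le_of_dvd (Nat.pos_of_ne_zero hq0) hr.2.1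
    rw [sum_range_coprime_eq_sum_units
      (fun b => (∑ d ∈ s, ‖expSum (N / d ^ 2) (d ^ 2 * ((b : ℝ) / r))‖) ^ 2)]
    exact sum_units_sq_sum_expSum_le hr.1 hB1
      (fun n hn hle => hB n hn (hle.trans (by nlinarith [Nat.pow_le_pow_left hrq 2]))) hKD
      (hrq.trans_lt hKq) (fun d hd => ⟨(hs d hd).1, (hs d hd).2.coprime_dvd_right hr.2.1⟩) hR0
      (hR r (Nat.pos_of_ne_zero hr0) hrq)
  refine (Finset.sum_le_card_nsmul _ _ _ e3).trans ?_
  rw [nsmul_eq_mul]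
  have h1 : ((q.divisors.erase 1).card : ℝ) ≤ B := by
    refine le_trans ?_ (hB q hq0 (by nlinarith [Nat.pos_of_ne_zero hq0]))
    exact_mod_cast Finset.card_le_card (Finset.erase_subset _ _)
  calc _ ≤ B * (8 * B ^ 2 * K ^ 4 * R) := by gcongr
    _ = _ := by ring

/-- If d has dyadic size 2^i then m ≤ N/4^i, so only d needs to be split: K blocks, costing K². -/
theorem sum_sq_large_sqMulCount_le {B R : ℝ} (hB1 : 1 ≤ B) (hR0 : 0 ≤ R) {N K D₀ : ℕ}
    (hqN : q ≤ N)
    (hB : ∀ n : ℕ, n ≠ 0 → n ≤ 4 * N ^ 2 → (n.divisors.card : ℝ) ≤ B)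
    (hK : N < 2 ^ K) {s : Finset ℕ}
    (hs : ∀ d ∈ s, d ∈ Finset.Ioc D₀ N ∧ d.Coprime q)
    (hR : ∀ D H : ℝ, D₀ ≤ D → 0 ≤ H → H * D ^ 2 ≤ 4 * N →
      D * H * (1 + D / √q) * (1 + H / √q) ≤ R) :
    ∑ a : (ZMod q)ˣ, (∑ d ∈ s, sqMulCount q (N / d ^ 2) d a) ^ 2 ≤ 2 * B ^ 2 * K ^ 2 * R := by
  have hq0 : 0 < q := Nat.pos_of_ne_zero (NeZero.ne q)
  set T : Finset ℕ := (Finset.range K).filter fun i => D₀ ≤ 2 ^ (i + 1) ∧ 2 ^ i ≤ N with hT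
  have hTcard : (T.card : ℝ) ≤ K := by
    have : T.card ≤ K := (Finset.card_filter_le _ _).trans (le_of_eq (Finset.card_range K))
    exact_mod_cast this
  have hcT : ∀ d ∈ s, Nat.log 2 d ∈ T := by
    intro d hd
    have hd1 := Finset.mem_Ioc.1 (hs d hd).1
    have e1 : 2 ^ Nat.log 2 d ≤ N := (Nat.pow_log_le_self 2 (by omega)).trans hd1.2
    have e2 := (Nat.lt_pow_succ_log_self one_lt_two d).le
    simp only [hT, Finset.mem_filter, Finset.mem_range]
    exact ⟨(Nat.pow_lt_pow_iff_right one_lt_two).1 (e1.trans_lt hK), hd1.1.le.trans e2, e1⟩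
  have hmain : ∀ i ∈ T, ∑ a : (ZMod q)ˣ,
      (∑ d ∈ s.filter (fun d => Nat.log 2 d = i), sqMulCount q (N / d ^ 2) d a) ^ 2
        ≤ 2 * B ^ 2 * R := by
    intro i hi
    simp only [hT, Finset.mem_filter] at hi
    have hiD : 2 ^ (i + 1) ≤ 2 * N := by rw [pow_succ]; omega
    have hcount := sum_sq_card_sq_mul_eq_le (q := q) hB1 (D := 2 ^ (i + 1)) (H := N / 4 ^ i)
      (s := s.filter (fun d => Nat.log 2 d = i)) (M := fun d => N / d ^ 2)
      (hB q hq0.ne' (by nlinarith))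
      (fun n hn hle => hB n hn (hle.trans (by nlinarith [Nat.pow_le_pow_left hiD 2])))
      (fun n hn hle => hB n hn (hle.trans
        (by nlinarith [Nat.pow_le_pow_left (Nat.div_le_self N (4 ^ i)) 2]))) ?_ ?_
    · refine hcount.trans (mul_le_mul_of_nonneg_left ?_ (by positivity))
      have := hR (2 ^ (i + 1)) ((N / 4 ^ i : ℕ) : ℝ) (by exact_mod_cast hi.2.1) (by positivity) ?_
      · push_cast at this ⊢
        exact this
      · have h4 : ((2 : ℝ) ^ (i + 1)) ^ 2 = 4 * 4 ^ i := by
          rw [← pow_mul, mul_comm, pow_mul]; norm_num [pow_succ]; ring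
        have h5 : ((N / 4 ^ i : ℕ) : ℝ) ≤ N / 4 ^ i := by
          refine Nat.cast_div_le.trans (le_of_eq ?_); push_cast; rfl
        calc _ ≤ (N / 4 ^ i : ℝ) * (4 * 4 ^ i) := by rw [h4]; gcongr
          _ = 4 * N := by field_simp
    · intro d hd
      simp only [Finset.mem_filter] at hd
      have hd1 := Finset.mem_Ioc.1 (hs d hd.1).1
      refine ⟨Finset.mem_Icc.2 ⟨by omega, ?_⟩, (hs d hd.1).2⟩
      rw [← hd.2]
      exact (Nat.lt_pow_succ_log_self one_lt_two d).le
    · intro d hd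
      simp only [Finset.mem_filter] at hd
      have hd1 := Finset.mem_Ioc.1 (hs d hd.1).1
      refine Nat.div_le_div_left ?_ (by positivity)
      rw [show (4 : ℕ) = 2 ^ 2 by norm_num, ← pow_mul, mul_comm, pow_mul, ← hd.2]
      exact Nat.pow_le_pow_left (Nat.pow_log_le_self 2 (by omega)) 2
  calc _ ≤ ∑ a : (ZMod q)ˣ, (K : ℝ) * ∑ i ∈ T,
        (∑ d ∈ s.filter (fun d => Nat.log 2 d = i), sqMulCount q (N / d ^ 2) d a) ^ 2 := by
        refine Finset.sum_le_sum fun a _ => ?_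
        rw [← Finset.sum_fiberwise_of_maps_to hcT]
        refine sq_sum_le_card_mul_sum_sq.trans ?_
        exact mul_le_mul_of_nonneg_right hTcard (Finset.sum_nonneg fun _ _ => by positivity)
    _ = (K : ℝ) * ∑ i ∈ T, ∑ a : (ZMod q)ˣ,
        (∑ d ∈ s.filter (fun d => Nat.log 2 d = i), sqMulCount q (N / d ^ 2) d a) ^ 2 := by
        rw [← Finset.mul_sum, Finset.sum_comm]
    _ ≤ (K : ℝ) * (T.card * (2 * B ^ 2 * R)) := by
        refine mul_le_mul_of_nonneg_left ?_ (by positivity)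
        rw [← nsmul_eq_mul]
        exact Finset.sum_le_card_nsmul _ _ _ hmain
    _ ≤ (K : ℝ) * (K * (2 * B ^ 2 * R)) := by gcongr
    _ = _ := by ring

/-! ### Size of the dyadic contributions. -/

/-- Here X = √x, s = √q, and r is the root of the reduced denominator. Of the four terms of the
expanded product, the last is of order s²y² = Xs³ and dictates the cutoff y; the second uses X ≤ s²,
that is √x ≤ q. -/
theorem small_range_bound {X s y r D H W : ℝ} (hs : 1 ≤ s) (hsX : s ≤ X) (hXs : X ≤ s ^ 2)
    (hy0 : 0 ≤ y) (hy : y ^ 2 = X * s) (hr0 : 0 < r) (hrs : r ≤ s) (hD0 : 0 ≤ D) (hD : D ≤ 4 * y)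
    (hH : 1 ≤ H) (hW0 : 0 ≤ W) (hWD : W * D ^ 2 ≤ 4 * X ^ 2) (hWH : W * H ≤ 2 * r ^ 2) :
    W ^ 2 * (D * H * (1 + D / r) * (1 + H / r)) ≤ 94 * (X * s ^ 3) := by
  have hX0 : 0 < X := by linarith
  have hs0 : 0 < s := by linarith
  have hyX : y ≤ X := by
    refine (pow_le_pow_iff_left₀ hy0 hX0.le two_ne_zero).1 ?_
    rw [hy, sq]; gcongr
  have hWH0 : 0 ≤ W * H := by positivity
  have hV2 : (W * H) ^ 2 ≤ (2 * r ^ 2) ^ 2 := pow_le_pow_left₀ hWH0 hWH 2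
  have hWr : W ≤ 2 * r ^ 2 := (le_mul_of_one_le_right hW0 hH).trans hWH
  have t1 : W ^ 2 * (D * H) ≤ 6 * (X * s ^ 3) := by
    -- Only the square of this term is a product of the controlled quantities WD², WH and W.
    refine (pow_le_pow_iff_left₀ (by positivity) (by positivity) two_ne_zero).1 ?_
    calc (W ^ 2 * (D * H)) ^ 2 = (W * D ^ 2) * ((W * H) ^ 2 * W) := by ring
      _ ≤ (4 * X ^ 2) * ((2 * r ^ 2) ^ 2 * (2 * r ^ 2)) := by gcongr
      _ = 32 * X ^ 2 * r ^ 6 := by ring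
      _ ≤ 36 * X ^ 2 * s ^ 6 := by gcongr; norm_num
      _ = _ := by ring
  have t2 : W ^ 2 * (D * H) * (D / r) ≤ 8 * (X * s ^ 3) := by
    calc W ^ 2 * (D * H) * (D / r) = (W * D ^ 2) * (W * H) / r := by ring
      _ ≤ (4 * X ^ 2) * (2 * r ^ 2) / r := by gcongr
      _ = 8 * X * (X * r) := by field_simp; ring
      _ ≤ 8 * X * (s ^ 2 * s) := by gcongr
      _ = _ := by ring
  have t3 : W ^ 2 * (D * H) * (H / r) ≤ 16 * (X * s ^ 3) := by
    calc W ^ 2 * (D * H) * (H / r) = (W * H) ^ 2 * D / r := by ring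
      _ ≤ (2 * r ^ 2) ^ 2 * (4 * X) / r := by gcongr; linarith
      _ = 16 * X * r ^ 3 := by field_simp; ring
      _ ≤ 16 * X * s ^ 3 := by gcongr
      _ = _ := by ring
  have t4 : W ^ 2 * (D * H) * (D / r * (H / r)) ≤ 64 * (X * s ^ 3) := by
    calc W ^ 2 * (D * H) * (D / r * (H / r)) = (W * H) ^ 2 * D ^ 2 / r ^ 2 := by ring
      _ ≤ (2 * r ^ 2) ^ 2 * (4 * y) ^ 2 / r ^ 2 := by gcongr
      _ = 64 * r ^ 2 * y ^ 2 := by field_simp; ring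
      _ ≤ 64 * s ^ 2 * y ^ 2 := by gcongr
      _ = _ := by rw [hy]; ring
  calc _ = W ^ 2 * (D * H) + W ^ 2 * (D * H) * (D / r) + W ^ 2 * (D * H) * (H / r)
        + W ^ 2 * (D * H) * (D / r * (H / r)) := by ring
    _ ≤ _ := by linarith

/-- Each term is rewritten through HD² ≤ 4X² with a nonpositive power of D left over, so D may be
replaced by y; X ≤ s² finishes. -/
theorem large_range_bound {X s y D H : ℝ} (hs : 1 ≤ s) (hsX : s ≤ X) (hXs : X ≤ s ^ 2)
    (hy0 : 0 ≤ y) (hy : y ^ 2 = X * s) (hD : y ≤ D) (hH : 0 ≤ H) (hHD : H * D ^ 2 ≤ 4 * X ^ 2) :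
    D * H * (1 + D / s) * (1 + H / s) ≤ 40 * (X * s) := by
  have hX0 : 0 < X := by linarith
  have hs0 : 0 < s := by linarith
  have hys : s ≤ y := by
    refine (pow_le_pow_iff_left₀ hs0.le hy0 two_ne_zero).1 ?_
    rw [hy, sq]; gcongr
  have hypos : 0 < y := by linarith
  have hD0 : 0 < D := by linarith
  have hXsy : X ≤ s * y := by nlinarith
  have t1 : D * H ≤ 4 * (X * s) := by
    calc D * H = H * D ^ 2 / D := by field_simp
      _ ≤ 4 * X ^ 2 / y := by gcongr
      _ ≤ 4 * (X * (s * y)) / y := by rw [sq]; gcongr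
      _ = _ := by field_simp
  have t2 : D * H * (D / s) ≤ 4 * (X * s) := by
    calc D * H * (D / s) = H * D ^ 2 / s := by ring
      _ ≤ 4 * X ^ 2 / s := by gcongr
      _ ≤ 4 * (X * s ^ 2) / s := by rw [sq]; gcongr
      _ = _ := by field_simp
  have t3 : D * H * (H / s) ≤ 16 * (X * s) := by
    calc D * H * (H / s) = (H * D ^ 2) ^ 2 / (D ^ 3 * s) := by field_simp
      _ ≤ (4 * X ^ 2) ^ 2 / (y ^ 3 * s) := by gcongr
      _ = 16 * (X * X ^ 3) / (y ^ 3 * s) := by ring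
      _ ≤ 16 * (X * (y ^ 3 * s ^ 2)) / (y ^ 3 * s) := by
          have : X ^ 3 ≤ y ^ 3 * s ^ 2 := by
            calc X ^ 3 = X * (X * X) := by ring
              _ ≤ X * (s ^ 2 * s ^ 2) := by gcongr
              _ = s * (X * s) * s ^ 2 := by ring
              _ ≤ y * (X * s) * s ^ 2 := by gcongr
              _ = _ := by rw [← hy]; ring
          gcongr
      _ = _ := by field_simp
  have t4 : D * H * (D / s * (H / s)) ≤ 16 * (X * s) := by
    calc D * H * (D / s * (H / s)) = (H * D ^ 2) ^ 2 / (D ^ 2 * s ^ 2) := by field_simp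
      _ ≤ (4 * X ^ 2) ^ 2 / (y ^ 2 * s ^ 2) := by gcongr
      _ = 16 * (X * (X * X)) / s ^ 3 := by rw [hy]; field_simp; norm_num
      _ ≤ 16 * (X * (s ^ 2 * s ^ 2)) / s ^ 3 := by gcongr
      _ = _ := by field_simp
  calc _ = D * H + D * H * (D / s) + D * H * (H / s) + D * H * (D / s * (H / s)) := by ring
    _ ≤ _ := by linarith

end

/-! ### Sieve identity, the density and the error decomposition. -/

-- Write n = b²a with a squarefree. Then d² ∣ n exactly when d ∣ b, and the sum of μ over the
-- divisors of b detects b = 1.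
open ArithmeticFunction in
theorem abs_moebius_eq_sum_sq_dvd {n N : ℕ} (hn : n ∈ Finset.Icc 1 N) :
    |(moebius n : ℝ)| = ∑ d ∈ Finset.Icc 1 N with d ^ 2 ∣ n, (moebius d : ℝ) := by
  rw [Finset.mem_Icc] at hn
  have hn0 : n ≠ 0 := by omega
  obtain ⟨a, b, hab, ha⟩ := Nat.sq_mul_squarefree n
  have hb0 : b ≠ 0 := by rintro rfl; simp at hab; omega
  have hset : (Finset.Icc 1 N).filter (fun d => d ^ 2 ∣ n) = b.divisors := by
    ext d
    simp only [Finset.mem_filter, Finset.mem_Icc, Nat.mem_divisors]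
    constructor
    · rintro ⟨hd, hdvd⟩
      refine ⟨?_, hb0⟩
      obtain ⟨g, d', b', hg, hco, rfl, rfl⟩ := Nat.exists_coprime' (Nat.gcd_pos_of_pos_left b hd.1)
      rw [← hab, mul_pow, mul_pow, mul_comm (d' ^ 2), mul_comm (b' ^ 2), mul_assoc] at hdvd
      have h1 := Nat.dvd_of_mul_dvd_mul_left (by positivity) hdvd
      have h2 := (Nat.Coprime.pow 2 2 hco).dvd_of_dvd_mul_left h1
      have h3 := ha d' (by rwa [← sq])
      rw [Nat.isUnit_iff] at h3
      rw [h3, one_mul]; exact Nat.dvd_mul_left _ _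
    · rintro ⟨hd, -⟩
      have hd2 : d ^ 2 ∣ n := hab ▸ (pow_dvd_pow_of_dvd hd 2).mul_right a
      have hd0 := Nat.pos_of_dvd_of_pos hd (Nat.pos_of_ne_zero hb0)
      exact ⟨⟨hd0, ((Nat.le_self_pow two_ne_zero d).trans (Nat.le_of_dvd (by omega) hd2)).trans hn.2⟩,
        hd2⟩
  rw [hset]
  have hsum : ∑ d ∈ b.divisors, (moebius d : ℝ) = if b = 1 then 1 else 0 := by
    have := congrArg (fun f : ArithmeticFunction ℤ => f b) coe_zeta_mul_moebius
    simp only [coe_zeta_mul_apply, one_apply] at this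
    exact_mod_cast this
  rw [hsum]
  by_cases hb : b = 1
  · rw [if_pos hb]
    have hsq : Squarefree n := by rw [← hab, hb]; simpa using ha
    exact_mod_cast abs_moebius_eq_one_of_squarefree hsq
  · rw [if_neg hb]
    have hsq : ¬ Squarefree n := fun h => hb (Nat.isUnit_iff.1 (h b (by
      rw [← sq, ← hab]; exact Nat.dvd_mul_right _ _)))
    rw [moebius_eq_zero_of_not_squarefree hsq]; simp

theorem abs_moebius_real_le_one (n : ℕ) : |(ArithmeticFunction.moebius n : ℝ)| ≤ 1 := by
  exact_mod_cast ArithmeticFunction.abs_moebius_le_one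

/-- Only d coprime to q survive, because d² divides some n lying in a unit class. -/
theorem S_eq_sum_moebius_mul_sqMulCount (x : ℝ) {q : ℕ} (a : (ZMod q)ˣ) :
    S x q a = ∑ d ∈ (Finset.Icc 1 ⌊x⌋₊).filter (fun d => d.Coprime q),
      (ArithmeticFunction.moebius d : ℝ) * sqMulCount q (⌊x⌋₊ / d ^ 2) d a := by
  set N := ⌊x⌋₊ with hN
  have h1 : S x q a = ∑ d ∈ Finset.Icc 1 N, (ArithmeticFunction.moebius d : ℝ) *
      (((Finset.Icc 1 N).filter fun n : ℕ => (n : ZMod q) = a ∧ d ^ 2 ∣ n).card : ℝ) := by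
    rw [S, ← hN, Finset.sum_congr rfl fun n hn =>
      abs_moebius_eq_sum_sq_dvd (Finset.mem_filter.1 hn).1]
    simp only [Finset.sum_filter, Finset.card_filter, Nat.cast_sum, Finset.mul_sum]
    have : ∀ n : ℕ, (if (n : ZMod q) = a then ∑ d ∈ Finset.Icc 1 N,
        (if d ^ 2 ∣ n then (ArithmeticFunction.moebius d : ℝ) else 0) else 0)
        = ∑ d ∈ Finset.Icc 1 N, (ArithmeticFunction.moebius d : ℝ) *
          ((if (n : ZMod q) = a ∧ d ^ 2 ∣ n then 1 else 0 : ℕ) : ℝ) := by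
      intro n
      by_cases h : (n : ZMod q) = a <;> simp [h]
    simp_rw [this]
    exact Finset.sum_comm
  rw [h1, Finset.sum_filter]
  refine Finset.sum_congr rfl fun d hd => ?_
  have hd0 : 0 < d := (Finset.mem_Icc.1 hd).1
  split_ifs with hco
  · congr 2
    symm
    refine Finset.card_bij (fun m _ => d ^ 2 * m) ?_ ?_ ?_
    · intro m hm
      simp only [Finset.mem_filter, Finset.mem_Icc] at hm ⊢
      refine ⟨⟨Nat.mul_pos (by positivity) hm.1.1, ?_⟩, hm.2, Nat.dvd_mul_right _ _⟩
      rw [mul_comm]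
      exact (Nat.le_div_iff_mul_le (by positivity)).1 hm.1.2
    · intro m _ m' _ h
      exact Nat.eq_of_mul_eq_mul_left (by positivity) h
    · intro n hn
      simp only [Finset.mem_filter, Finset.mem_Icc] at hn
      obtain ⟨hn1, hna, m, rfl⟩ := hn
      refine ⟨m, ?_, rfl⟩
      simp only [Finset.mem_filter, Finset.mem_Icc]
      refine ⟨⟨Nat.pos_of_mul_pos_left hn1.1, ?_⟩, hna⟩
      rw [Nat.le_div_iff_mul_le (by positivity), mul_comm]
      exact hn1.2
  · have : (Finset.Icc 1 N).filter (fun n : ℕ => (n : ZMod q) = a ∧ d ^ 2 ∣ n) = ∅ := by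
      refine Finset.filter_eq_empty_iff.2 fun n _ h => hco ?_
      have hu : IsUnit (n : ZMod q) := h.1 ▸ a.isUnit
      rw [ZMod.isUnit_iff_coprime] at hu
      exact (hu.coprime_dvd_left h.2).coprime_dvd_left (dvd_pow_self d two_ne_zero)
    rw [this]; simp

/-- The general term of the Dirichlet series whose value is `c_q`. -/
noncomputable def densityTerm (q n : ℕ) : ℝ :=
  if n.Coprime q then (ArithmeticFunction.moebius n : ℝ) / (n : ℝ) ^ 2 else 0

theorem abs_densityTerm_le (q n : ℕ) : |densityTerm q n| ≤ ((n : ℝ) ^ 2)⁻¹ := by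
  unfold densityTerm
  split_ifs
  · rw [abs_div, abs_of_nonneg (sq_nonneg (n : ℝ)), ← one_div]
    gcongr
    exact abs_moebius_real_le_one n
  · rw [abs_zero]; positivity

theorem summable_abs_densityTerm (q : ℕ) : Summable fun n => ‖densityTerm q n‖ :=
  Summable.of_nonneg_of_le (fun _ => norm_nonneg _) (abs_densityTerm_le q)
    (Real.summable_nat_pow_inv.2 one_lt_two)

/-- Euler product: μ kills higher prime powers, so the local factor is 1 - 1/p² when p ∤ q and 1
otherwise. -/
theorem tsum_densityTerm_eq_c (q : ℕ) : ∑' n, densityTerm q n = c q := by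
  have h0 : densityTerm q 0 = 0 := by simp [densityTerm]
  have h1 : densityTerm q 1 = 1 := by simp [densityTerm]
  have hmul : ∀ {m n : ℕ}, m.Coprime n →
      densityTerm q (m * n) = densityTerm q m * densityTerm q n := by
    intro m n hmn
    unfold densityTerm
    rw [ArithmeticFunction.isMultiplicative_moebius.map_mul_of_coprime hmn]
    by_cases hm : m.Coprime q
    · by_cases hn : n.Coprime q
      · rw [if_pos (Nat.Coprime.mul_left hm hn), if_pos hm, if_pos hn]
        push_cast
        ring
      · rw [if_neg (fun h => hn (h.coprime_dvd_left (Nat.dvd_mul_left n m))), if_neg hn, mul_zero]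
    · rw [if_neg (fun h => hm (h.coprime_dvd_left (Nat.dvd_mul_right m n))), if_neg hm, zero_mul]
  have hprod := EulerProduct.eulerProduct_hasProd_mulIndicator h1 hmul
    (summable_abs_densityTerm q) h0
  have hc := hasProd_c q
  rw [show (fun p : {p : ℕ // p.Prime ∧ ¬ p ∣ q} => 1 - 1 / ((p : ℕ) : ℝ) ^ 2)
    = (fun p : ℕ => 1 - 1 / (p : ℝ) ^ 2) ∘ (Subtype.val : {p : ℕ | p.Prime ∧ ¬ p ∣ q} → ℕ) from rfl]
    at hc
  have hc' := (hasProd_subtype_iff_mulIndicator (s := {p : ℕ | p.Prime ∧ ¬ p ∣ q})).1 hc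
  have hfun : Set.mulIndicator {p | Nat.Prime p} (fun p => ∑' e, densityTerm q (p ^ e))
      = Set.mulIndicator {p | Nat.Prime p ∧ ¬ p ∣ q} (fun p => 1 - 1 / (p : ℝ) ^ 2) := by
    funext p
    by_cases hp : p.Prime
    · rw [Set.mulIndicator_of_mem (show p ∈ {p | Nat.Prime p} from hp),
        tsum_eq_sum (s := Finset.range 2), Finset.sum_range_succ, Finset.sum_range_one, pow_zero,
        pow_one, h1]
      · by_cases hpq : p ∣ q
        · rw [Set.mulIndicator_of_notMem (fun h => h.2 hpq), densityTerm,
            if_neg (fun h => (hp.coprime_iff_not_dvd.1 h) hpq), add_zero]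
        · rw [Set.mulIndicator_of_mem (show p ∈ {p | Nat.Prime p ∧ ¬ p ∣ q} from ⟨hp, hpq⟩),
            densityTerm, if_pos (hp.coprime_iff_not_dvd.2 hpq),
            ArithmeticFunction.moebius_apply_prime hp]
          push_cast
          ring
      · intro e he
        have he2 : 1 < e := by simpa using he
        rw [densityTerm, ArithmeticFunction.moebius_apply_prime_pow hp (by omega),
            if_neg (show ¬ e = 1 by omega)]
        simp
    · rw [Set.mulIndicator_of_notMem (show p ∉ {p | Nat.Prime p} from hp),
        Set.mulIndicator_of_notMem (fun h => hp h.1)]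
  rw [hfun] at hprod
  exact hprod.unique hc'

theorem abs_sum_densityTerm_sub_c_le (q : ℕ) {D : ℕ} (hD : D ≠ 0) :
    |∑ d ∈ Finset.Icc 1 D, densityTerm q d - c q| ≤ 1 / D := by
  have hs : HasSum (densityTerm q) (c q) := by
    rw [← tsum_densityTerm_eq_c]
    exact (summable_abs_densityTerm q).of_norm.hasSum
  have ht := hs.tendsto_sum_nat
  have h0 : densityTerm q 0 = 0 := by simp [densityTerm]
  have hlim := (tendsto_const_nhds (x := ∑ d ∈ Finset.Icc 1 D, densityTerm q d)).sub ht |>.abs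
  refine le_of_tendsto hlim (Filter.eventually_atTop.2 ⟨D + 1, fun n hn => ?_⟩)
  obtain ⟨k, rfl⟩ : ∃ k, n = k + 1 := ⟨n - 1, by omega⟩
  have hDk : D ≤ k := by omega
  have hsplit : ∑ i ∈ Finset.range (k + 1), densityTerm q i
      = ∑ d ∈ Finset.Icc 1 D, densityTerm q d + ∑ d ∈ Finset.Ioc D k, densityTerm q d := by
    rw [Finset.range_eq_Ico, ← Finset.sum_Ico_consecutive _ (Nat.zero_le (D + 1)) (by omega),
      Finset.sum_eq_sum_Ico_succ_bot (by omega), h0, zero_add]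
    congr 2
    ext d
    simp only [Finset.mem_Ico, Finset.mem_Ioc]
    omega
  rw [hsplit, sub_add_cancel_left, abs_neg]
  calc _ ≤ ∑ d ∈ Finset.Ioc D k, |densityTerm q d| := Finset.abs_sum_le_sum_abs _ _
    _ ≤ ∑ d ∈ Finset.Ioc D k, ((d : ℝ) ^ 2)⁻¹ :=
        Finset.sum_le_sum fun d _ => abs_densityTerm_le q d
    _ ≤ (D : ℝ)⁻¹ - (k : ℝ)⁻¹ := sum_Ioc_inv_sq_le_sub hD hDk
    _ ≤ 1 / D := by rw [one_div]; linarith [show (0 : ℝ) ≤ (k : ℝ)⁻¹ by positivity]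

/-- Removing the floor costs at most 1 for each d ≤ D; completing the series costs x times its tail
1/D. -/
theorem abs_main_term_sub_le {x : ℝ} (hx : 0 ≤ x) (q : ℕ) {D : ℕ} (hD : D ≠ 0) :
    |∑ d ∈ (Finset.Icc 1 D).filter (fun d => d.Coprime q),
        (ArithmeticFunction.moebius d : ℝ) * (((⌊x⌋₊ / d ^ 2 : ℕ) : ℝ) / q) - c q * (x / q)|
      ≤ (D + x / D) / q := by
  have h1 : ∑ d ∈ (Finset.Icc 1 D).filter (fun d => d.Coprime q),
        (ArithmeticFunction.moebius d : ℝ) * (((⌊x⌋₊ / d ^ 2 : ℕ) : ℝ) / q) - c q * (x / q)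
      = (∑ d ∈ (Finset.Icc 1 D).filter (fun d => d.Coprime q),
          (ArithmeticFunction.moebius d : ℝ) * (((⌊x⌋₊ / d ^ 2 : ℕ) : ℝ) - x / (d : ℝ) ^ 2)
        + (∑ d ∈ Finset.Icc 1 D, densityTerm q d - c q) * x) / q := by
    have : ∑ d ∈ Finset.Icc 1 D, densityTerm q d
        = ∑ d ∈ (Finset.Icc 1 D).filter (fun d => d.Coprime q),
          (ArithmeticFunction.moebius d : ℝ) / (d : ℝ) ^ 2 := by
      rw [Finset.sum_filter]; rfl
    rw [this, sub_mul, ← add_sub_assoc, Finset.sum_mul, ← Finset.sum_add_distrib, sub_div,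
      Finset.sum_div, mul_div_assoc]
    congr 1
    refine Finset.sum_congr rfl fun d _ => ?_
    ring
  have h2 : |∑ d ∈ (Finset.Icc 1 D).filter (fun d => d.Coprime q),
      (ArithmeticFunction.moebius d : ℝ) * (((⌊x⌋₊ / d ^ 2 : ℕ) : ℝ) - x / (d : ℝ) ^ 2)| ≤ D := by
    calc _ ≤ ∑ d ∈ (Finset.Icc 1 D).filter (fun d => d.Coprime q), (1 : ℝ) := by
          refine (Finset.abs_sum_le_sum_abs _ _).trans (Finset.sum_le_sum fun d _ => ?_)
          rw [abs_mul]
          refine mul_le_one₀ (abs_moebius_real_le_one d) (abs_nonneg _) ?_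
          rw [← Nat.floor_div_natCast, Nat.cast_pow, abs_sub_comm, abs_le]
          have e1 := Nat.floor_le (show 0 ≤ x / (d : ℝ) ^ 2 by positivity)
          have e2 := Nat.lt_floor_add_one (x / (d : ℝ) ^ 2)
          constructor <;> linarith
      _ ≤ ∑ d ∈ Finset.Icc 1 D, (1 : ℝ) :=
          Finset.sum_le_sum_of_subset_of_nonneg (Finset.filter_subset _ _) fun _ _ _ => zero_le_one
      _ = D := by simp
  have h3 := abs_sum_densityTerm_sub_c_le q hD
  rw [h1, abs_div, Nat.abs_cast]
  refine div_le_div_of_nonneg_right ?_ (Nat.cast_nonneg _)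
  refine (abs_add_le _ _).trans (add_le_add h2 ?_)
  rw [abs_mul, abs_of_nonneg hx, div_eq_mul_one_div, mul_comm x]
  gcongr

theorem abs_E_le {x : ℝ} (hx : 0 ≤ x) {q : ℕ} {D : ℕ} (hD : D ≠ 0) (hDN : D ≤ ⌊x⌋₊) (a : (ZMod q)ˣ) :
    |E x q a| ≤ |∑ d ∈ (Finset.Icc 1 D).filter (fun d => d.Coprime q),
          (ArithmeticFunction.moebius d : ℝ) *
            (sqMulCount q (⌊x⌋₊ / d ^ 2) d a - ((⌊x⌋₊ / d ^ 2 : ℕ) : ℝ) / q)|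
      + ∑ d ∈ (Finset.Ioc D ⌊x⌋₊).filter (fun d => d.Coprime q), sqMulCount q (⌊x⌋₊ / d ^ 2) d a
      + (D + x / D) / q := by
  set N := ⌊x⌋₊ with hN
  have hunion : (Finset.Icc 1 N).filter (fun d => d.Coprime q)
      = (Finset.Icc 1 D).filter (fun d => d.Coprime q)
        ∪ (Finset.Ioc D N).filter (fun d => d.Coprime q) := by
    ext d
    simp only [Finset.mem_filter, Finset.mem_union, Finset.mem_Icc, Finset.mem_Ioc]
    constructor
    · rintro ⟨h, hco⟩
      rcases le_or_gt d D with h' | h'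
      · exact Or.inl ⟨⟨h.1, h'⟩, hco⟩
      · exact Or.inr ⟨⟨h', h.2⟩, hco⟩
    · rintro (⟨h, hco⟩ | ⟨h, hco⟩)
      · exact ⟨⟨h.1, h.2.trans hDN⟩, hco⟩
      · exact ⟨⟨by omega, h.2⟩, hco⟩
  have hdisj : Disjoint ((Finset.Icc 1 D).filter (fun d => d.Coprime q))
      ((Finset.Ioc D N).filter (fun d => d.Coprime q)) := by
    rw [Finset.disjoint_left]
    intro d h1 h2
    simp only [Finset.mem_filter, Finset.mem_Icc, Finset.mem_Ioc] at h1 h2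
    omega
  have hE : E x q a = ∑ d ∈ (Finset.Icc 1 D).filter (fun d => d.Coprime q),
        (ArithmeticFunction.moebius d : ℝ) *
          (sqMulCount q (N / d ^ 2) d a - ((N / d ^ 2 : ℕ) : ℝ) / q)
      + ∑ d ∈ (Finset.Ioc D N).filter (fun d => d.Coprime q),
        (ArithmeticFunction.moebius d : ℝ) * sqMulCount q (N / d ^ 2) d a
      + (∑ d ∈ (Finset.Icc 1 D).filter (fun d => d.Coprime q),
        (ArithmeticFunction.moebius d : ℝ) * (((N / d ^ 2 : ℕ) : ℝ) / q) - c q * (x / q)) := by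
    rw [E, S_eq_sum_moebius_mul_sqMulCount, ← hN, hunion, Finset.sum_union hdisj]
    simp only [mul_sub, Finset.sum_sub_distrib]
    ring
  rw [hE]
  refine (abs_add_le _ _).trans (add_le_add ?_ (abs_main_term_sub_le hx q hD))
  refine (abs_add_le _ _).trans (add_le_add le_rfl ?_)
  refine (Finset.abs_sum_le_sum_abs _ _).trans (Finset.sum_le_sum fun d _ => ?_)
  have h0 : 0 ≤ sqMulCount q (N / d ^ 2) d (a : ZMod q) := by unfold sqMulCount; positivity
  rw [abs_mul, abs_of_nonneg h0]
  exact mul_le_of_le_one_left h0 (abs_moebius_real_le_one d)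

/-! ### Variance of E and Chebyshev's inequality. -/

theorem sqrt_sqrt_mul_sqrt_le {x : ℝ} {q : ℕ} (hXq : √x ≤ q) (hqx : (q : ℝ) ≤ x) :
    √(√x * √q) ≤ q := by
  rw [Real.sqrt_le_left (Nat.cast_nonneg q), sq]
  have : √(q : ℝ) ≤ √x := Real.sqrt_le_sqrt hqx
  exact mul_le_mul hXq (this.trans hXq) (Real.sqrt_nonneg _) (Nat.cast_nonneg q)

theorem main_term_bound {X s y : ℝ} (hs : 1 ≤ s) (hX0 : 0 < X) (hXs : X ≤ s ^ 2) (hy0 : 0 < y)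
    (hy : y ^ 2 = X * s) :
    ((2 * y + X ^ 2 / y) / s ^ 2) ^ 2 * s ^ 2 ≤ 10 * (X * s) := by
  have hs0 : 0 < s := by linarith
  have e1 : 8 * (X * s) ≤ 8 * (X * s) * s ^ 2 :=
    le_mul_of_one_le_right (by positivity) (one_le_pow₀ hs)
  have e2 : 2 * (X * X ^ 2 / s) ≤ 2 * (X * (s ^ 2) ^ 2 / s) := by gcongr
  calc ((2 * y + X ^ 2 / y) / s ^ 2) ^ 2 * s ^ 2 = (2 * y + X ^ 2 / y) ^ 2 / s ^ 2 := by field_simp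
    _ ≤ (2 * ((2 * y) ^ 2 + (X ^ 2 / y) ^ 2)) / s ^ 2 := by
        gcongr
        nlinarith [sq_nonneg (2 * y - X ^ 2 / y)]
    _ = (8 * (X * s) + 2 * (X * X ^ 2 / s)) / s ^ 2 := by
        rw [div_pow, mul_pow, hy]; field_simp; ring
    _ ≤ (8 * (X * s) * s ^ 2 + 2 * (X * (s ^ 2) ^ 2 / s)) / s ^ 2 :=
        div_le_div_of_nonneg_right (add_le_add e1 e2) (sq_nonneg s)
    _ = _ := by field_simp; ring

set_option maxHeartbeats 800000 in
/-- The variance of `E(x; q, ·)` over the reduced residue classes, up to divisor-function factors. -/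
theorem sum_sq_E_le {x : ℝ} (hx : 1 ≤ x) {q : ℕ} [NeZero q] (hXq : √x ≤ q) (hqx : (q : ℝ) ≤ x)
    {B : ℝ} (hB1 : 1 ≤ B)
    (hB : ∀ n : ℕ, n ≠ 0 → (n : ℝ) ≤ 8 * x ^ 2 → (n.divisors.card : ℝ) ≤ B) :
    ∑ a : (ZMod q)ˣ, E x q a ^ 2 ≤ 2526 * B ^ 7 * (√x * √q) := by
  have hx0 : 0 ≤ x := by linarith
  have hB0 : 0 ≤ B := by linarith
  set N := ⌊x⌋₊ with hN
  have hNx : (N : ℝ) ≤ x := Nat.floor_le hx0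
  have hq1 : 1 ≤ q := Nat.pos_of_ne_zero (NeZero.ne q)
  have hqN : q ≤ N := Nat.le_floor hqx
  set X := √x with hX
  set s := √(q : ℝ) with hs
  have hX2 : X ^ 2 = x := Real.sq_sqrt hx0
  have hs2 : s ^ 2 = q := Real.sq_sqrt (Nat.cast_nonneg q)
  have hs1 : 1 ≤ s := Real.one_le_sqrt.2 (by exact_mod_cast hq1)
  have hsX : s ≤ X := Real.sqrt_le_sqrt hqx
  have hXs : X ≤ s ^ 2 := hs2 ▸ hXq
  have hX0 : 0 < X := by linarith
  have hs0 : 0 < s := by linarith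
  set y := √(X * s) with hy
  have hy2 : y ^ 2 = X * s := Real.sq_sqrt (by positivity)
  have hy1 : 1 ≤ y := Real.one_le_sqrt.2 (by nlinarith)
  have hyq : y ≤ q := sqrt_sqrt_mul_sqrt_le hXq hqx
  set D := ⌈y⌉₊ with hD
  have hyD : y ≤ D := Nat.le_ceil y
  have hDy : (D : ℝ) ≤ 2 * y := by
    have := Nat.ceil_lt_add_one (show 0 ≤ y by linarith)
    linarith
  have hDq : D ≤ q := Nat.ceil_le.2 hyq
  have hD0 : D ≠ 0 := (Nat.ceil_pos.2 (by linarith)).ne'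
  have hDN : D ≤ N := hDq.trans hqN
  have hN2 : (N : ℝ) ^ 2 ≤ x ^ 2 := by gcongr
  have hBN : ∀ n : ℕ, n ≠ 0 → n ≤ 8 * N ^ 2 → (n.divisors.card : ℝ) ≤ B := by
    intro n hn hle
    refine hB n hn ?_
    calc (n : ℝ) ≤ 8 * (N : ℝ) ^ 2 := by exact_mod_cast hle
      _ ≤ _ := by linarith
  set K := Nat.log 2 N + 1 with hK
  have hNK : N < 2 ^ K := Nat.lt_pow_succ_log_self one_lt_two N
  -- 2^(K-1) ≤ N has exactly K divisors, so the logarithmic losses are absorbed into B as well.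
  have hKB : (K : ℝ) ≤ B := by
    have h1 : 2 ^ Nat.log 2 N ≤ N := Nat.pow_log_le_self 2 (by omega)
    have h2 := hBN (2 ^ Nat.log 2 N) (by positivity) (by nlinarith)
    rwa [Nat.divisors_prime_pow Nat.prime_two, Finset.card_map, Finset.card_range] at h2
  have hB7 : 1 ≤ B ^ 7 := one_le_pow₀ hB1
  have hXs0 : 0 < X * s := by positivity
  set V₁ : (ZMod q)ˣ → ℝ := fun a => ∑ d ∈ (Finset.Icc 1 D).filter (fun d => d.Coprime q),
    (ArithmeticFunction.moebius d : ℝ) *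
      (sqMulCount q (N / d ^ 2) d a - ((N / d ^ 2 : ℕ) : ℝ) / q) with hV₁
  set V₂ : (ZMod q)ˣ → ℝ := fun a => ∑ d ∈ (Finset.Ioc D N).filter (fun d => d.Coprime q),
    sqMulCount q (N / d ^ 2) d a with hV₂
  have h1 : ∑ a, V₁ a ^ 2 ≤ 752 * B ^ 7 * (X * s) := by
    have h := sum_sq_small_sqMulCount_le (q := q) (N := N) (K := K) (D₀ := D)
      (R := 94 * (X * s ^ 3)) hB1 (by positivity)
      (fun n hn hle => hBN n hn (hle.trans (by
        nlinarith [Nat.pow_le_pow_left hDN 2, Nat.pow_le_pow_left hqN 2])))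
      (hDN.trans_lt hNK) (hqN.trans_lt hNK)
      (s := (Finset.Icc 1 D).filter (fun d => d.Coprime q))
      (fun d hd => Finset.mem_filter.1 hd) (fun d => (ArithmeticFunction.moebius d : ℝ))
      abs_moebius_real_le_one ?_
    · have h2 : ∑ a, V₁ a ^ 2 ≤ ∑ a : ZMod q,
          (∑ d ∈ (Finset.Icc 1 D).filter (fun d => d.Coprime q),
            (ArithmeticFunction.moebius d : ℝ) *
              (sqMulCount q (N / d ^ 2) d a - ((N / d ^ 2 : ℕ) : ℝ) / q)) ^ 2 := by
        -- By positivity the sum over units may be extended to all residues, where Parseval is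
        -- available.
        rw [← Finset.sum_image (s := Finset.univ) (g := fun a : (ZMod q)ˣ => (a : ZMod q))
          (f := fun a : ZMod q => (∑ d ∈ (Finset.Icc 1 D).filter (fun d => d.Coprime q),
            (ArithmeticFunction.moebius d : ℝ) *
              (sqMulCount q (N / d ^ 2) d a - ((N / d ^ 2 : ℕ) : ℝ) / q)) ^ 2)
          (fun a _ b _ h => Units.ext h)]
        exact Finset.sum_le_sum_of_subset_of_nonneg (Finset.subset_univ _)
          fun _ _ _ => sq_nonneg _
      refine le_of_mul_le_mul_left ?_ (show (0 : ℝ) < s ^ 2 by positivity)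
      calc s ^ 2 * ∑ a, V₁ a ^ 2 ≤ q * _ := by
            rw [hs2]; exact mul_le_mul_of_nonneg_left h2 (Nat.cast_nonneg q)
        _ ≤ 8 * B ^ 3 * K ^ 4 * (94 * (X * s ^ 3)) := h
        _ ≤ 8 * B ^ 3 * B ^ 4 * (94 * (X * s ^ 3)) := by gcongr
        _ = _ := by ring
    · intro r hr1 hrq D' H W hD2 hD' hH hW hWD hWH
      refine small_range_bound hs1 hsX hXs (by linarith) hy2 (Real.sqrt_pos.2 (by exact_mod_cast hr1))
        (Real.sqrt_le_sqrt (by exact_mod_cast hrq)) (by linarith) (by linarith) (by linarith) hW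
        (by rw [hX2]; linarith) ?_
      rwa [Real.sq_sqrt (Nat.cast_nonneg r)]
  have h2 : ∑ a, V₂ a ^ 2 ≤ 80 * B ^ 7 * (X * s) := by
    have h := sum_sq_large_sqMulCount_le (q := q) (N := N) (K := K) (D₀ := D)
      (R := 40 * (X * s)) hB1 (by positivity) hqN (fun n hn hle => hBN n hn (by omega)) hNK
      (s := (Finset.Ioc D N).filter (fun d => d.Coprime q)) (fun d hd => Finset.mem_filter.1 hd) ?_
    · calc _ ≤ 2 * B ^ 2 * K ^ 2 * (40 * (X * s)) := h
        _ ≤ 2 * B ^ 2 * B ^ 2 * (40 * (X * s)) := by gcongr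
        _ = 80 * B ^ 4 * (X * s) := by ring
        _ ≤ 80 * B ^ 7 * (X * s) := by gcongr; norm_num
    · intro D' H hD' hH hHD
      exact large_range_bound hs1 hsX hXs (by linarith) hy2 (hyD.trans hD') hH
        (by rw [hX2]; linarith)
  have h3 : ((D + x / D) / q) ^ 2 * q ≤ 10 * (X * s) := by
    have e1 : (D + x / D) / q ≤ (2 * y + X ^ 2 / y) / s ^ 2 := by
      rw [hX2, hs2]; gcongr
    have e2 : ((D + x / D) / q) ^ 2 ≤ ((2 * y + X ^ 2 / y) / s ^ 2) ^ 2 :=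
      pow_le_pow_left₀ (by positivity) e1 2
    calc ((D + x / D) / q) ^ 2 * q ≤ ((2 * y + X ^ 2 / y) / s ^ 2) ^ 2 * s ^ 2 := by
          rw [hs2] at e2 ⊢; gcongr
      _ ≤ _ := main_term_bound hs1 hX0 hXs (by linarith) hy2
  have h4 : ∑ _a : (ZMod q)ˣ, ((D + x / D) / q) ^ 2 ≤ 10 * B ^ 7 * (X * s) := by
    rw [Finset.sum_const, Finset.card_univ, ZMod.card_units_eq_totient, nsmul_eq_mul]
    calc (q.totient : ℝ) * ((D + x / D) / q) ^ 2 ≤ q * ((D + x / D) / q) ^ 2 := by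
          gcongr; exact_mod_cast Nat.totient_le q
      _ ≤ 10 * (X * s) := by rw [mul_comm]; exact h3
      _ ≤ 10 * B ^ 7 * (X * s) := by nlinarith
  calc ∑ a : (ZMod q)ˣ, E x q a ^ 2
      ≤ ∑ a : (ZMod q)ˣ, 3 * (V₁ a ^ 2 + V₂ a ^ 2 + ((D + x / D) / q) ^ 2) := by
        refine Finset.sum_le_sum fun a _ => ?_
        have h := abs_E_le hx0 hD0 hDN a
        have h' := pow_le_pow_left₀ (abs_nonneg _) h 2
        rw [sq_abs] at h'
        refine h'.trans ?_
        have e : V₁ a ^ 2 = |V₁ a| ^ 2 := (sq_abs _).symm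
        rw [e]
        change (|V₁ a| + V₂ a + (D + x / D) / q) ^ 2 ≤ _
        nlinarith [sq_nonneg (|V₁ a| - V₂ a), sq_nonneg (|V₁ a| - (D + x / D) / q),
          sq_nonneg (V₂ a - (D + x / D) / q)]
    _ = 3 * (∑ a, V₁ a ^ 2 + ∑ a, V₂ a ^ 2 + ∑ _a : (ZMod q)ˣ, ((D + x / D) / q) ^ 2) := by
        rw [← Finset.mul_sum, Finset.sum_add_distrib, Finset.sum_add_distrib]
    _ ≤ 3 * (752 * B ^ 7 * (X * s) + 80 * B ^ 7 * (X * s) + 10 * B ^ 7 * (X * s)) := by gcongr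
    _ = _ := by ring

theorem ncard_lt_abs_mul_sq_le {α : Type*} [Fintype α] (f : α → ℝ) {T : ℝ} (hT : 0 ≤ T) :
    ({a | T < |f a|}.ncard : ℝ) * T ^ 2 ≤ ∑ a, f a ^ 2 := by
  classical
  have hset : {a | T < |f a|} = ((Finset.univ.filter fun a => T < |f a| : Finset α) : Set α) := by
    ext; simp
  rw [hset, Set.ncard_coe_finset, ← nsmul_eq_mul]
  refine (Finset.card_nsmul_le_sum _ (fun a => f a ^ 2) _ fun a ha => ?_).trans
    (Finset.sum_le_sum_of_subset_of_nonneg (Finset.subset_univ _) fun _ _ _ => sq_nonneg _)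
  rw [← sq_abs (f a)]
  exact pow_le_pow_left₀ hT (Finset.mem_filter.1 ha).2.le 2

end SquarefreeAP

theorem corollary2 (ε : ℝ) (hε : 0 < ε) :
    ∃ C : ℝ, 0 < C ∧ ∀ (x : ℝ) (q : ℕ), 1 ≤ x → 1 ≤ q →
      x ^ (1 / 2 : ℝ) ≤ (q : ℝ) → (q : ℝ) ≤ x →
      (1 / (Nat.totient q : ℝ)) *
          (Set.ncard {a : (ZMod q)ˣ |
            (x / (q : ℝ)) ^ (1 / 4 : ℝ) * x ^ ε < |SquarefreeAP.E x q a|} : ℝ)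
        ≤ C * x ^ (-ε) := by
  -- With n ≤ 8x², exponent ε/16 gives B of order x^(ε/8). Seven factors B come from the variance
  -- and one from replacing q by φ(q), so the total loss is x^ε against the gain x^(2ε).
  obtain ⟨C, hC1, hC⟩ := SquarefreeAP.exists_card_divisors_le_rpow (δ := ε / 16) (by positivity)
  refine ⟨2526 * (C * 8 ^ (ε / 16)) ^ 8, by positivity, fun x q hx hq hXq hqx => ?_⟩
  have : NeZero q := ⟨by omega⟩
  have hx0 : 0 < x := by linarith
  have hq0 : (0 : ℝ) < q := by exact_mod_cast hq
  rw [← Real.sqrt_eq_rpow] at hXq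
  set B : ℝ := C * 8 ^ (ε / 16) * x ^ (ε / 8) with hBdef
  have hB1 : 1 ≤ B := by
    have h1 : (1 : ℝ) ≤ 8 ^ (ε / 16) := Real.one_le_rpow (by norm_num) (by positivity)
    have h2 : (1 : ℝ) ≤ x ^ (ε / 8) := Real.one_le_rpow hx (by positivity)
    exact one_le_mul_of_one_le_of_one_le (one_le_mul_of_one_le_of_one_le hC1 h1) h2
  have hB0 : 0 ≤ B := by linarith
  have hB : ∀ n : ℕ, n ≠ 0 → (n : ℝ) ≤ 8 * x ^ 2 → (n.divisors.card : ℝ) ≤ B := by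
    intro n hn hle
    refine (hC n hn).trans ?_
    calc C * (n : ℝ) ^ (ε / 16) ≤ C * (8 * x ^ 2) ^ (ε / 16) := by gcongr
      _ = B := by
        rw [hBdef, Real.mul_rpow (by norm_num) (by positivity), ← Real.rpow_natCast x 2,
          ← Real.rpow_mul hx0.le, mul_assoc]
        congr 3
        push_cast; ring
  have hvar := SquarefreeAP.sum_sq_E_le hx hXq hqx hB1 hB
  have hcheb := SquarefreeAP.ncard_lt_abs_mul_sq_le (fun a => SquarefreeAP.E x q a)
    (T := (x / (q : ℝ)) ^ (1 / 4 : ℝ) * x ^ ε) (by positivity)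
  set n : ℝ := (Set.ncard {a : (ZMod q)ˣ |
    (x / (q : ℝ)) ^ (1 / 4 : ℝ) * x ^ ε < |SquarefreeAP.E x q a|} : ℝ) with hn
  have hT : ((x / (q : ℝ)) ^ (1 / 4 : ℝ) * x ^ ε) ^ 2 = √x / √q * (x ^ ε) ^ 2 := by
    rw [mul_pow, ← Real.rpow_natCast ((x / (q : ℝ)) ^ (1 / 4 : ℝ)) 2,
      ← Real.rpow_mul (by positivity), ← Real.sqrt_div hx0.le, Real.sqrt_eq_rpow]
    norm_num
  rw [hT] at hcheb
  have hφ : (0 : ℝ) < q.totient := by exact_mod_cast Nat.totient_pos.2 hq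
  have hqφ : (q : ℝ) ≤ q.totient * B := by
    have h1 : (q : ℝ) ≤ q.totient * q.divisors.card := by
      exact_mod_cast SquarefreeAP.le_totient_mul_card_divisors (by omega : q ≠ 0)
    have h2 := hB q (by omega) (by nlinarith)
    exact h1.trans (by gcongr)
  have hX : 0 < √x := Real.sqrt_pos.2 hx0
  have hs : 0 < √(q : ℝ) := Real.sqrt_pos.2 hq0
  have hs2 : √(q : ℝ) * √q = q := Real.mul_self_sqrt hq0.le
  have hxε : 0 < x ^ ε := by positivity
  have h1 : n * (x ^ ε) ^ 2 ≤ 2526 * B ^ 7 * q := by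
    have h := hcheb.trans hvar
    refine le_of_mul_le_mul_left ?_ (div_pos hX hs)
    calc √x / √q * (n * (x ^ ε) ^ 2) = n * (√x / √q * (x ^ ε) ^ 2) := by ring
      _ ≤ _ := h
      _ = √x / √q * (2526 * B ^ 7 * (√q * √q)) := by field_simp
      _ = _ := by rw [hs2]
  have hB8 : B ^ 8 = (C * 8 ^ (ε / 16)) ^ 8 * x ^ ε := by
    rw [hBdef, mul_pow _ (x ^ (ε / 8)), ← Real.rpow_natCast (x ^ (ε / 8)) 8,
      ← Real.rpow_mul hx0.le]
    norm_num
  have h2 : n * (x ^ ε) ^ 2 ≤ q.totient * (2526 * (C * 8 ^ (ε / 16)) ^ 8) * x ^ ε := by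
    calc _ ≤ 2526 * B ^ 7 * (q.totient * B) := h1.trans (by gcongr)
      _ = 2526 * q.totient * B ^ 8 := by ring
      _ = _ := by rw [hB8]; ring
  have h3 : n * x ^ ε ≤ q.totient * (2526 * (C * 8 ^ (ε / 16)) ^ 8) := by
    refine le_of_mul_le_mul_right ?_ hxε
    rw [mul_assoc, ← sq]; exact h2
  rw [Real.rpow_neg hx0.le, ← div_eq_mul_inv, le_div_iff₀ hxε, one_div, inv_mul_eq_div,
    div_mul_eq_mul_div, div_le_iff₀ hφ]
  linarith
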